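/- Let $B$ be a closed braid on at least one strand, given by a braid diagram, let $l\ge 1$ be its number of components, and let $H_0(B)$ be the HOMFLYPT homology of $B$ with rational coefficients, in the following normalization. Construction. Mark finitely many distinct points on $B$, away from the crossings, at least one on each arc between crossings and on each circle without crossings. Attach a variable to each of them and let $R=\mathbb{Q}[a,x_1,\dots,x_m]$, with $(\deg_a,\deg_x)$ equal to $(2,0)$ on $a$ and $(0,2)$ on the $x_i$. For homogeneous $a_0,a_1\in R$ with $\deg a_0+\deg a_1=(2,2)$ (where $a_0=0$ is regarded as having degree $(2,2)-\deg a_1$) let $(a_0,a_1)$ be the $\mathbb{Z}_2\times\mathbb{Z}^2$-graded matrix factorization $R\xrightarrow{a_0}R\{(1,1)-\deg a_0\}\xrightarrow{a_1}R$. Here $\{j,k\}$ shifts the bidegree up by $(j,k)$ and $\langle 1\rangle$ exchanges the two $\mathbb{Z}_2$-degrees. An arc from $x_i$ to $x_s$ gets $C_0=(a,x_s-x_i)$, in homological degree $0$. For a crossing with lower endpoints $x_i,x_j$ and upper endpoints $x_s,x_t$ (from left to right), put $C_0(\Gamma_0)=(a,x_s-x_i)\otimes(a,x_t-x_j)$ and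 $C_0(\Gamma_1)=(a,x_s+x_t-x_i-x_j)\otimes(0,x_sx_t-x_ix_j)\{0,-1\}$. Let $\chi^0:C_0(\Gamma_0)\to C_0(\Gamma_1)$ and $\chi^1:C_0(\Gamma_1)\to C_0(\Gamma_0)$ be the Khovanov–Rozansky morphisms. They have degree $(0,1)$, and both compositions are multiplication by $x_j-x_s$. Explicitly, let $1,\theta_1,\theta_2,\theta_1\theta_2$ and $1,\eta_1,\eta_2,\eta_1\eta_2$ be the bases of $C_0(\Gamma_0)$ and $C_0(\Gamma_1)$, whose indices denote the rows. Then $\chi^1$ sends $1\mapsto 1$, $\eta_1\mapsto\theta_1+\theta_2$, $\eta_2\mapsto x_j\theta_1+x_s\theta_2$, $\eta_1\eta_2\mapsto(x_s-x_j)\theta_1\theta_2$, and $\chi^0$ sends $1\mapsto x_j-x_s$, $\theta_1\mapsto\eta_2-x_s\eta_1$, $\theta_2\mapsto x_j\eta_1-\eta_2$, $\theta_1\theta_2\mapsto-\eta_1\eta_2$. A positive crossing gets the complex $C_0(\Gamma_1)\langle1\rangle\{1,0\}\xrightarrow{\chi^1}C_0(\Gamma_0)\langle1\rangle\{1,-1\}$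 in homological degrees $-1,0$. A negative crossing gets $C_0(\Gamma_0)\langle1\rangle\{-1,1\}\xrightarrow{\chi^0}C_0(\Gamma_1)\langle1\rangle\{-1,0\}$ in homological degrees $0,1$. Let $C_0(B)$ be the tensor product over $R$ of the complexes of all pieces into which the marked points cut $B$, with the usual signs. It is a complex of matrix factorizations of $0$. Let $d_{mf}$ be its matrix factorization differential and $d_\chi$ the differential of the complex, and let $H_0(B)=H(H(C_0(B),d_{mf}),d_\chi)$. Let $H_0^{i,j,k}(B)$ be its component of homological degree $i$, $a$-degree $j$ and $x$-degree $k$. Claim. For every marking of $B$, all $H_0^{i,j,k}(B)$ are finite-dimensional. For all $(i,j)\in\mathbb{Z}^2$ there is a polynomial $P_{B,i,j}\in\mathbb{Q}[T]$ with $\dim_{\mathbb{Q}}H_0^{i,j,2T-j}(B)=P_{B,i,j}(T)$ for all large positive integers $T$, and $P_{B,i,j}=0$ for all but finitely many $(i,j)$. So the Hilbert polynomial $P_B=\sum_{(i,j)}P_{B,i,j}$ of $H_0(B)$ with respect to the polynomial grading $\deg_a+\deg_x$ exists and is unique. Its degree is at most $l-1$ (the zero polynomial has degree $-\infty$). -/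

import Mathlib

/-! ## The bigraded polynomial ring -/

/-- The ring `R = ℚ[a, x_1, …, x_n]`, with one variable `x` for every marked point `x : X`;
the variable indexed by `none` is `a`. -/
abbrev PolyRing (X : Type*) := MvPolynomial (Option X) ℚ

/-- The variable `a`. -/
noncomputable abbrev aVar (X : Type*) : PolyRing X := MvPolynomial.X none

/-- The variable attached to the marked point `x`. -/
noncomputable abbrev xVar {X : Type*} (x : X) : PolyRing X := MvPolynomial.X (some x)

/-- The `ℤ²`-grading `(deg_a, deg_x)` of `R`: `deg a = (2,0)`, `deg x_i = (0,2)`. -/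
def bidegree {X : Type*} : Option X → ℤ × ℤ
  | none => (2, 0)
  | some _ => (0, 2)

/-- `r` is homogeneous of bidegree `e` (the zero element is homogeneous of every bidegree). -/
abbrev IsHomog {X : Type*} (r : PolyRing X) (e : ℤ × ℤ) : Prop :=
  MvPolynomial.IsWeightedHomogeneous bidegree r e

theorem isHomog_zero {X : Type*} (e : ℤ × ℤ) : IsHomog (0 : PolyRing X) e :=
  MvPolynomial.isWeightedHomogeneous_zero ℚ _ e

theorem isHomog_one {X : Type*} : IsHomog (1 : PolyRing X) 0 :=
  MvPolynomial.isWeightedHomogeneous_one ℚ _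

theorem isHomog_aVar {X : Type*} : IsHomog (aVar X) (2, 0) :=
  MvPolynomial.isWeightedHomogeneous_X ℚ bidegree none

theorem isHomog_xVar {X : Type*} (x : X) : IsHomog (xVar x) (0, 2) :=
  MvPolynomial.isWeightedHomogeneous_X ℚ bidegree (some x)

theorem IsHomog.add {X : Type*} {r s : PolyRing X} {e : ℤ × ℤ} (hr : IsHomog r e)
    (hs : IsHomog s e) : IsHomog (r + s) e :=
  (MvPolynomial.weightedHomogeneousSubmodule ℚ bidegree e).add_mem hr hs

theorem IsHomog.neg {X : Type*} {r : PolyRing X} {e : ℤ × ℤ} (hr : IsHomog r e) :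
    IsHomog (-r) e :=
  (MvPolynomial.weightedHomogeneousSubmodule ℚ bidegree e).neg_mem hr

theorem IsHomog.sub {X : Type*} {r s : PolyRing X} {e : ℤ × ℤ} (hr : IsHomog r e)
    (hs : IsHomog s e) : IsHomog (r - s) e :=
  (MvPolynomial.weightedHomogeneousSubmodule ℚ bidegree e).sub_mem hr hs

theorem IsHomog.mul {X : Type*} {r s : PolyRing X} {e f : ℤ × ℤ} (hr : IsHomog r e)
    (hs : IsHomog s f) : IsHomog (r * s) (e + f) :=
  MvPolynomial.IsWeightedHomogeneous.mul hr hs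

theorem IsHomog.of_eq {X : Type*} {r : PolyRing X} {e f : ℤ × ℤ} (hr : IsHomog r e)
    (h : e = f) : IsHomog r f := h ▸ hr

/-- The sign `(-1)^p`, for a parity `p`. -/
def paritySign (R : Type*) [Ring R] (p : ZMod 2) : R := if p = 0 then 1 else -1

theorem paritySign_add_one (R : Type*) [Ring R] (p : ZMod 2) :
    paritySign R (p + 1) = -paritySign R p := by
  have hp : p = 0 ∨ p = 1 := by revert p; decide
  rcases hp with rfl | rfl
  · simp [paritySign]
  · have h : (1 : ZMod 2) + 1 = 0 := by decide
    simp [paritySign, h]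

theorem paritySign_mul_self (R : Type*) [Ring R] (p : ZMod 2) :
    paritySign R p * paritySign R p = 1 := by
  unfold paritySign; split_ifs <;> simp

theorem isHomog_paritySign {X : Type*} (p : ZMod 2) : IsHomog (paritySign (PolyRing X) p) 0 := by
  unfold paritySign; split_ifs
  · exact isHomog_one
  · exact isHomog_one.neg

theorem isHomog_one_apply {X ι : Type*} [DecidableEq ι] (deg : ι → ℤ × ℤ) (i j : ι) :
    IsHomog ((1 : Matrix ι ι (PolyRing X)) i j) (deg j - deg i) := by
  by_cases h : i = j
  · subst h; rw [Matrix.one_apply_eq, sub_self]; exact isHomog_one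
  · rw [Matrix.one_apply_ne h]; exact isHomog_zero _

theorem isHomog_sign_apply {X ι : Type*} [DecidableEq ι] (deg : ι → ℤ × ℤ) (p : ι → ZMod 2)
    (i j : ι) :
    IsHomog (Matrix.diagonal (fun k => paritySign (PolyRing X) (p k)) i j) (deg j - deg i) := by
  by_cases h : i = j
  · subst h; rw [Matrix.diagonal_apply_eq, sub_self]; exact isHomog_paritySign _
  · rw [Matrix.diagonal_apply_ne _ h]; exact isHomog_zero _

/-- A matrix that shifts a parity by one anticommutes with the associated sign matrix. -/
theorem sign_mul_of_odd {R ι : Type*} [CommRing R] [Fintype ι] [DecidableEq ι]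
    (p : ι → ZMod 2) (D : Matrix ι ι R) (h : ∀ i j, D i j ≠ 0 → p i = p j + 1) :
    Matrix.diagonal (fun k => paritySign R (p k)) * D =
      -(D * Matrix.diagonal (fun k => paritySign R (p k))) := by
  ext i j
  rw [Matrix.neg_apply, Matrix.diagonal_mul, Matrix.mul_diagonal]
  by_cases hD : D i j = 0
  · simp [hD]
  · rw [h i j hD, paritySign_add_one]; ring

/-- A matrix that preserves a parity commutes with the associated sign matrix. -/
theorem sign_mul_of_even {R ι : Type*} [CommRing R] [Fintype ι] [DecidableEq ι]
    (p : ι → ZMod 2) (D : Matrix ι ι R) (h : ∀ i j, D i j ≠ 0 → p i = p j) :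
    Matrix.diagonal (fun k => paritySign R (p k)) * D =
      D * Matrix.diagonal (fun k => paritySign R (p k)) := by
  ext i j
  rw [Matrix.diagonal_mul, Matrix.mul_diagonal]
  by_cases hD : D i j = 0
  · simp [hD]
  · rw [h i j hD]; ring

theorem sign_mul_sign {R ι : Type*} [CommRing R] [Fintype ι] [DecidableEq ι] (p : ι → ZMod 2) :
    Matrix.diagonal (fun k => paritySign R (p k)) * Matrix.diagonal (fun k => paritySign R (p k))
      = (1 : Matrix ι ι R) := by
  rw [Matrix.diagonal_mul_diagonal]
  simp only [paritySign_mul_self]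
  exact Matrix.diagonal_one

open scoped Kronecker in
/-- The matrix of `D ⊗ id + (-1)^p ⊗ E` on a tensor product of free modules, that is of
`m ⊗ m' ↦ D m ⊗ m' + (-1)^{p(m)} m ⊗ E m'`. -/
def leibniz {R ι κ : Type*} [CommRing R] [DecidableEq ι] [DecidableEq κ]
    (p : ι → ZMod 2) (D : Matrix ι ι R) (E : Matrix κ κ R) : Matrix (ι × κ) (ι × κ) R :=
  D ⊗ₖ (1 : Matrix κ κ R) + Matrix.diagonal (fun k => paritySign R (p k)) ⊗ₖ E

theorem leibniz_ne_zero {R ι κ : Type*} [CommRing R] [DecidableEq ι] [DecidableEq κ]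
    {p : ι → ZMod 2} {D : Matrix ι ι R} {E : Matrix κ κ R} {i j : ι × κ}
    (h : leibniz p D E i j ≠ 0) :
    (D i.1 j.1 ≠ 0 ∧ i.2 = j.2) ∨ (i.1 = j.1 ∧ E i.2 j.2 ≠ 0) := by
  rw [leibniz, Matrix.add_apply, Matrix.kronecker_apply, Matrix.kronecker_apply] at h
  by_cases h1 : D i.1 j.1 * (1 : Matrix κ κ R) i.2 j.2 = 0
  · rw [h1, zero_add] at h
    refine Or.inr ⟨?_, right_ne_zero_of_mul h⟩
    by_contra hne
    exact left_ne_zero_of_mul h (Matrix.diagonal_apply_ne _ hne)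
  · refine Or.inl ⟨left_ne_zero_of_mul h1, ?_⟩
    by_contra hne
    exact right_ne_zero_of_mul h1 (Matrix.one_apply_ne hne)

theorem leibniz_homog {X ι κ : Type*} [DecidableEq ι] [DecidableEq κ]
    (p : ι → ZMod 2) {D : Matrix ι ι (PolyRing X)} {E : Matrix κ κ (PolyRing X)}
    {deg : ι → ℤ × ℤ} {deg' : κ → ℤ × ℤ} {e : ℤ × ℤ}
    (hD : ∀ i j, IsHomog (D i j) (deg j - deg i + e))
    (hE : ∀ i j, IsHomog (E i j) (deg' j - deg' i + e)) (i j : ι × κ) :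
    IsHomog (leibniz p D E i j) (deg j.1 + deg' j.2 - (deg i.1 + deg' i.2) + e) := by
  rw [leibniz, Matrix.add_apply, Matrix.kronecker_apply, Matrix.kronecker_apply]
  refine IsHomog.add ?_ ?_
  · exact ((hD _ _).mul (isHomog_one_apply deg' i.2 j.2)).of_eq (by abel)
  · exact ((isHomog_sign_apply deg p i.1 j.1).mul (hE _ _)).of_eq (by abel)

theorem leibniz_sq {R ι κ : Type*} [CommRing R] [Fintype ι] [Fintype κ] [DecidableEq ι]
    [DecidableEq κ] (p : ι → ZMod 2) {D : Matrix ι ι R} {E : Matrix κ κ R} {v w : R}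
    (hp : ∀ i j, D i j ≠ 0 → p i = p j + 1) (hD : D * D = v • (1 : Matrix ι ι R))
    (hE : E * E = w • (1 : Matrix κ κ R)) :
    leibniz p D E * leibniz p D E = (v + w) • (1 : Matrix (ι × κ) (ι × κ) R) := by
  rw [leibniz, add_mul, mul_add, mul_add, ← Matrix.mul_kronecker_mul, ← Matrix.mul_kronecker_mul,
    ← Matrix.mul_kronecker_mul, ← Matrix.mul_kronecker_mul, hD, hE, sign_mul_of_odd p D hp,
    sign_mul_sign, one_mul, mul_one, one_mul, Matrix.smul_kronecker, Matrix.kronecker_smul,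
    Matrix.one_kronecker_one, add_smul]
  ext i j
  simp only [Matrix.add_apply, Matrix.kroneckerMap_apply, Matrix.neg_apply]
  ring

theorem leibniz_comm {R ι κ : Type*} [CommRing R] [Fintype ι] [Fintype κ] [DecidableEq ι]
    [DecidableEq κ] (p q : ι → ZMod 2) {D D' : Matrix ι ι R} {E E' : Matrix κ κ R}
    (hq : ∀ i j, D i j ≠ 0 → q i = q j) (hp : ∀ i j, D' i j ≠ 0 → p i = p j)
    (hD : D' * D = D * D') (hE : E' * E = E * E') :
    leibniz q D' E' * leibniz p D E = leibniz p D E * leibniz q D' E' := by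
  simp only [leibniz]
  rw [add_mul, mul_add, mul_add, add_mul, mul_add, mul_add]
  simp only [← Matrix.mul_kronecker_mul]
  rw [hD, hE, sign_mul_of_even q D hq, sign_mul_of_even p D' hp]
  simp only [one_mul, mul_one, Matrix.diagonal_mul_diagonal]
  rw [funext fun i => mul_comm (paritySign R (q i)) (paritySign R (p i))]
  abel

/-! ## Graded matrix factorizations -/

/-- A finitely generated `ℤ₂ × ℤ²`-graded matrix factorization over `R = ℚ[a, x_1, …, x_n]`,
presented by a homogeneous basis.  The underlying free module `M = M₀ ⊕ M₁` is `R^ι`; the basis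
vector `e_i` lies in `M_{par i}` and has `(a, x)`-bidegree `deg i`.  The matrix of the total
differential `d = d₀ ⊕ d₁` is `d`, that is `d e_j = ∑ i, d i j • e_i`. -/
structure MatFac (X : Type*) where
  ι : Type
  fintype : Fintype ι
  decEq : DecidableEq ι
  par : ι → ZMod 2
  deg : ι → ℤ × ℤ
  /-- the element that is factorized -/
  pot : PolyRing X
  d : Matrix ι ι (PolyRing X)
  pot_homog : IsHomog pot (2, 2)
  d_par : ∀ i j, d i j ≠ 0 → par i = par j + 1
  d_homog : ∀ i j, IsHomog (d i j) (deg j - deg i + (1, 1))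
  d_sq : d * d = pot • (1 : Matrix ι ι (PolyRing X))

attribute [instance] MatFac.fintype MatFac.decEq

/-- The Koszul matrix factorization `(a₀, a₁)_R`, i.e.
`R --a₀--> R{1 - deg_a a₀, 1 - deg_x a₀} --a₁--> R`, where `deg a₀ = e`. -/
noncomputable def koszulRow {X : Type*} (a₀ a₁ : PolyRing X) (e : ℤ × ℤ) (h₀ : IsHomog a₀ e)
    (h₁ : IsHomog a₁ ((2, 2) - e)) : MatFac X where
  ι := Fin 2
  fintype := inferInstance
  decEq := inferInstance
  par := ![0, 1]
  deg := ![0, (1, 1) - e]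
  pot := a₀ * a₁
  d := !![0, a₁; a₀, 0]
  pot_homog := (h₀.mul h₁).of_eq (by abel)
  d_par := by
    intro i j
    fin_cases i <;> fin_cases j <;> simp
    intro _; decide
  d_homog := by
    intro i j
    fin_cases i <;> fin_cases j
    · exact isHomog_zero _
    · exact h₁.of_eq (by ext <;> simp <;> ring)
    · exact h₀.of_eq (by ext <;> simp)
    · exact isHomog_zero _
  d_sq := by
    ext i j
    fin_cases i <;> fin_cases j <;> simp [Matrix.mul_apply, Fin.sum_univ_two, mul_comm]

/-- The shift of a matrix factorization: `M.shift 0 (j,k)` is `M{j,k}`, and `M.shift 1 (j,k)` is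
`M⟨1⟩{j,k}`. -/
noncomputable def MatFac.shift {X : Type*} (M : MatFac X) (p : ZMod 2) (e : ℤ × ℤ) : MatFac X where
  ι := M.ι
  fintype := M.fintype
  decEq := M.decEq
  par := fun i => M.par i + p
  deg := fun i => M.deg i + e
  pot := M.pot
  d := M.d
  pot_homog := M.pot_homog
  d_par := fun i j h => by rw [M.d_par i j h]; ring
  d_homog := fun i j => (M.d_homog i j).of_eq (by abel)
  d_sq := M.d_sq

/-- The tensor product over `R`, with `d (m ⊗ m') = d m ⊗ m' + (-1)^{par m} m ⊗ d m'`.  The free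
module with basis `M.ι × N.ι` is the tensor product of the two free modules, and the matrix of a
tensor product of linear maps is the Kronecker product. -/
noncomputable def MatFac.tensor {X : Type*} (M N : MatFac X) : MatFac X where
  ι := M.ι × N.ι
  fintype := inferInstance
  decEq := inferInstance
  par := fun i => M.par i.1 + N.par i.2
  deg := fun i => M.deg i.1 + N.deg i.2
  pot := M.pot + N.pot
  d := leibniz M.par M.d N.d
  pot_homog := IsHomog.add M.pot_homog N.pot_homog
  d_par := by
    intro i j h
    rcases leibniz_ne_zero h with ⟨h1, h2⟩ | ⟨h1, h2⟩
    · rw [M.d_par _ _ h1, h2]; ring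
    · rw [N.d_par _ _ h2, h1]; ring
  d_homog := leibniz_homog M.par M.d_homog N.d_homog
  d_sq := leibniz_sq M.par M.d_par M.d_sq N.d_sq

/-! ## Complexes of graded matrix factorizations -/

/-- A bounded complex of graded matrix factorizations of one and the same potential, presented by
a homogeneous basis: `hdeg` is the homological degree of the basis vectors, `d` is the differential
`d_mf` of the matrix factorizations, and `dχ` is the differential of the complex, which consists of
morphisms of graded matrix factorizations. -/
structure MatFacComplex (X : Type*) extends MatFac X where
  hdeg : ι → ℤ
  dχ : Matrix ι ι (PolyRing X)
  d_hdeg : ∀ i j, d i j ≠ 0 → hdeg i = hdeg j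
  dχ_hdeg : ∀ i j, dχ i j ≠ 0 → hdeg i = hdeg j + 1
  dχ_par : ∀ i j, dχ i j ≠ 0 → par i = par j
  dχ_homog : ∀ i j, IsHomog (dχ i j) (deg j - deg i)
  dχ_sq : dχ * dχ = 0
  dχ_comm : dχ * d = d * dχ

/-- The complex with the single term `M`, in homological degree `0`. -/
noncomputable def MatFac.single {X : Type*} (M : MatFac X) : MatFacComplex X where
  toMatFac := M
  hdeg := fun _ => 0
  dχ := 0
  d_hdeg := fun _ _ _ => rfl
  dχ_hdeg := fun _ _ h => absurd rfl h
  dχ_par := fun _ _ h => absurd rfl h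
  dχ_homog := fun _ _ => isHomog_zero _
  dχ_sq := by simp
  dχ_comm := by simp

/-- The two-term complex `0 → M --f--> N → 0`, with `M` in homological degree `h` and `N` in
homological degree `h + 1`, for a morphism `f` (of degree `(0,0)`) of matrix factorizations. -/
noncomputable def twoTerm {X : Type*} (h : ℤ) (M N : MatFac X) (f : Matrix N.ι M.ι (PolyRing X))
    (hpot : M.pot = N.pot) (hpar : ∀ i j, f i j ≠ 0 → N.par i = M.par j)
    (hhom : ∀ i j, IsHomog (f i j) (M.deg j - N.deg i)) (hcomm : f * M.d = N.d * f) :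
    MatFacComplex X where
  ι := M.ι ⊕ N.ι
  fintype := inferInstance
  decEq := inferInstance
  par := Sum.elim M.par N.par
  deg := Sum.elim M.deg N.deg
  pot := M.pot
  d := Matrix.fromBlocks M.d 0 0 N.d
  pot_homog := M.pot_homog
  d_par := by
    rintro (i | i) (j | j) hij
    · exact M.d_par i j hij
    · exact absurd rfl hij
    · exact absurd rfl hij
    · exact N.d_par i j hij
  d_homog := by
    rintro (i | i) (j | j)
    · exact M.d_homog i j
    · exact isHomog_zero _
    · exact isHomog_zero _
    · exact N.d_homog i j
  d_sq := by
    rw [Matrix.fromBlocks_multiply, M.d_sq, N.d_sq, ← hpot, ← Matrix.fromBlocks_one,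
      Matrix.fromBlocks_smul]
    simp
  hdeg := Sum.elim (fun _ => h) (fun _ => h + 1)
  dχ := Matrix.fromBlocks 0 0 f 0
  d_hdeg := by
    rintro (i | i) (j | j) hij
    · rfl
    · exact absurd rfl hij
    · exact absurd rfl hij
    · rfl
  dχ_hdeg := by
    rintro (i | i) (j | j) hij
    · exact absurd rfl hij
    · exact absurd rfl hij
    · rfl
    · exact absurd rfl hij
  dχ_par := by
    rintro (i | i) (j | j) hij
    · exact absurd rfl hij
    · exact absurd rfl hij
    · exact hpar i j hij
    · exact absurd rfl hij
  dχ_homog := by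
    rintro (i | i) (j | j)
    · exact isHomog_zero _
    · exact isHomog_zero _
    · exact hhom i j
    · exact isHomog_zero _
  dχ_sq := by
    rw [Matrix.fromBlocks_multiply]; simp
  dχ_comm := by
    rw [Matrix.fromBlocks_multiply, Matrix.fromBlocks_multiply]; simp [hcomm]

/-- The tensor product over `R` of two complexes of matrix factorizations, with
`d_χ (m ⊗ m') = d_χ m ⊗ m' + (-1)^{hdeg m} m ⊗ d_χ m'`. -/
noncomputable def MatFacComplex.tensor {X : Type*} (M N : MatFacComplex X) : MatFacComplex X where
  toMatFac := M.toMatFac.tensor N.toMatFac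
  hdeg := fun i => M.hdeg i.1 + N.hdeg i.2
  dχ := leibniz (fun i => ((M.hdeg i : ℤ) : ZMod 2)) M.dχ N.dχ
  d_hdeg := by
    intro i j h
    rcases leibniz_ne_zero h with ⟨h1, h2⟩ | ⟨h1, h2⟩
    · rw [M.d_hdeg _ _ h1, h2]
    · rw [N.d_hdeg _ _ h2, h1]
  dχ_hdeg := by
    intro i j h
    rcases leibniz_ne_zero h with ⟨h1, h2⟩ | ⟨h1, h2⟩
    · rw [M.dχ_hdeg _ _ h1, h2]; ring
    · rw [N.dχ_hdeg _ _ h2, h1]; ring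
  dχ_par := by
    intro i j h
    change M.par i.1 + N.par i.2 = M.par j.1 + N.par j.2
    rcases leibniz_ne_zero h with ⟨h1, h2⟩ | ⟨h1, h2⟩
    · rw [M.dχ_par _ _ h1, h2]
    · rw [N.dχ_par _ _ h2, h1]
  dχ_homog := fun i j =>
    (leibniz_homog _ (e := 0) (fun i j => (M.dχ_homog i j).of_eq (add_zero _).symm)
      (fun i j => (N.dχ_homog i j).of_eq (add_zero _).symm) i j).of_eq (add_zero _)
  dχ_sq := by
    have h := leibniz_sq (fun i => ((M.hdeg i : ℤ) : ZMod 2)) (v := 0) (w := 0)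
      (fun i j hij => by rw [M.dχ_hdeg i j hij]; push_cast; ring)
      (M.dχ_sq.trans (zero_smul _ _).symm) (N.dχ_sq.trans (zero_smul _ _).symm)
    rw [add_zero, zero_smul] at h
    exact h
  dχ_comm := leibniz_comm M.par (fun i => ((M.hdeg i : ℤ) : ZMod 2))
    (fun i j h => by rw [M.d_hdeg i j h]) M.dχ_par M.dχ_comm N.dχ_comm

/-- The empty tensor product: `R` itself, in degree `0`, with zero differentials. -/
noncomputable def MatFacComplex.unit (X : Type*) : MatFacComplex X :=
  MatFac.single
    { ι := Unit
      fintype := inferInstance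
      decEq := inferInstance
      par := fun _ => 0
      deg := fun _ => 0
      pot := 0
      d := 0
      pot_homog := isHomog_zero _
      d_par := fun _ _ h => absurd rfl h
      d_homog := fun _ _ => isHomog_zero _
      d_sq := by simp }

/-! ## The complexes of the elementary pieces -/

/-- The matrix factorization `(a, x_s - x_i)` of an arc that starts at `x_i` and ends at `x_s`. -/
noncomputable def arcFac {X : Type*} (i s : X) : MatFac X :=
  koszulRow (aVar X) (xVar s - xVar i) (2, 0) isHomog_aVar
    (((isHomog_xVar s).sub (isHomog_xVar i)).of_eq rfl)

/-- The matrix factorization of the oriented resolution `Γ₀`: two parallel arcs, from `x_i` to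
`x_s` and from `x_j` to `x_t`. -/
noncomputable def gammaZero {X : Type*} (i j s t : X) : MatFac X :=
  (arcFac i s).tensor (arcFac j t)

/-- The matrix factorization of the singular resolution `Γ₁`: one `4`-valent vertex with incoming
edges `x_i, x_j` and outgoing edges `x_s, x_t`.  It is the Koszul matrix factorization with rows
`(a, x_s + x_t - x_i - x_j)` and `(0, x_s x_t - x_i x_j)`, shifted by `{0,-1}`. -/
noncomputable def gammaOne {X : Type*} (i j s t : X) : MatFac X :=
  ((koszulRow (aVar X) (xVar s + xVar t - xVar i - xVar j) (2, 0) isHomog_aVar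
      (((((isHomog_xVar s).add (isHomog_xVar t)).sub (isHomog_xVar i)).sub
        (isHomog_xVar j)).of_eq rfl)).tensor
    (koszulRow 0 (xVar s * xVar t - xVar i * xVar j) (2, -2) (isHomog_zero _)
      ((((isHomog_xVar s).mul (isHomog_xVar t)).sub
        ((isHomog_xVar i).mul (isHomog_xVar j))).of_eq rfl))).shift 0 (0, -1)

/-- The morphism `χ⁰ : C₀(Γ₀) → C₀(Γ₁)` of degree `(0,1)`.  Rows and columns are in the order
`1⊗1, 1⊗θ, θ⊗1, θ⊗θ`, where `1, θ` are the generators of a Koszul row. -/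
noncomputable def chiZero {X : Type*} (i j s t : X) :
    Matrix (gammaOne i j s t).ι (gammaZero i j s t).ι (PolyRing X) :=
  Matrix.submatrix
    !![xVar j - xVar s, 0, 0, 0;
       0, -1, 1, 0;
       0, xVar j, -xVar s, 0;
       0, 0, 0, -1]
    (finProdFinEquiv : Fin 2 × Fin 2 ≃ Fin 4) (finProdFinEquiv : Fin 2 × Fin 2 ≃ Fin 4)

/-- The morphism `χ¹ : C₀(Γ₁) → C₀(Γ₀)` of degree `(0,1)`, in the same order of the bases. -/
noncomputable def chiOne {X : Type*} (i j s t : X) :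
    Matrix (gammaZero i j s t).ι (gammaOne i j s t).ι (PolyRing X) :=
  Matrix.submatrix
    !![1, 0, 0, 0;
       0, xVar s, 1, 0;
       0, xVar j, 1, 0;
       0, 0, 0, xVar s - xVar j]
    (finProdFinEquiv : Fin 2 × Fin 2 ≃ Fin 4) (finProdFinEquiv : Fin 2 × Fin 2 ≃ Fin 4)

/-- The differential of the Koszul matrix factorization with rows `(a₀, a₁)` and `(b₀, b₁)`. -/
theorem leibniz_koszul {R : Type*} [CommRing R] (a₀ a₁ b₀ b₁ : R) :
    leibniz (![0, 1] : Fin 2 → ZMod 2) !![0, a₁; a₀, 0] !![0, b₁; b₀, 0] =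
      Matrix.submatrix
        !![0, b₁, a₁, 0;
           b₀, 0, 0, a₁;
           a₀, 0, 0, -b₁;
           0, a₀, -b₀, 0]
        finProdFinEquiv finProdFinEquiv := by
  ext ⟨i, i'⟩ ⟨j, j'⟩
  fin_cases i <;> fin_cases i' <;> fin_cases j <;> fin_cases j' <;>
    simp [leibniz, paritySign, finProdFinEquiv]

/-- `χ¹` commutes with the differentials of `C₀(Γ₁)` and `C₀(Γ₀)`. -/
theorem chiOne_comm {X : Type*} (i j s t : X) :
    chiOne i j s t * (gammaOne i j s t).d = (gammaZero i j s t).d * chiOne i j s t := by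
  change Matrix.submatrix
        !![1, 0, 0, 0; 0, xVar s, 1, 0; 0, xVar j, 1, 0; 0, 0, 0, xVar s - xVar j]
        finProdFinEquiv finProdFinEquiv *
      leibniz (![0, 1] : Fin 2 → ZMod 2) !![0, xVar s + xVar t - xVar i - xVar j; aVar X, 0]
        !![0, xVar s * xVar t - xVar i * xVar j; 0, 0] =
    leibniz (![0, 1] : Fin 2 → ZMod 2) !![0, xVar s - xVar i; aVar X, 0]
        !![0, xVar t - xVar j; aVar X, 0] *
      Matrix.submatrix
        !![1, 0, 0, 0; 0, xVar s, 1, 0; 0, xVar j, 1, 0; 0, 0, 0, xVar s - xVar j]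
        finProdFinEquiv finProdFinEquiv
  rw [leibniz_koszul, leibniz_koszul, Matrix.submatrix_mul_equiv, Matrix.submatrix_mul_equiv]
  congr 1
  refine Matrix.ext fun k l => ?_
  fin_cases k <;> fin_cases l <;> simp [Matrix.mul_apply, Fin.sum_univ_four] <;> ring

/-- `χ⁰` commutes with the differentials of `C₀(Γ₀)` and `C₀(Γ₁)`. -/
theorem chiZero_comm {X : Type*} (i j s t : X) :
    chiZero i j s t * (gammaZero i j s t).d = (gammaOne i j s t).d * chiZero i j s t := by
  change Matrix.submatrix
        !![xVar j - xVar s, 0, 0, 0; 0, -1, 1, 0; 0, xVar j, -xVar s, 0; 0, 0, 0, -1]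
        finProdFinEquiv finProdFinEquiv *
      leibniz (![0, 1] : Fin 2 → ZMod 2) !![0, xVar s - xVar i; aVar X, 0]
        !![0, xVar t - xVar j; aVar X, 0] =
    leibniz (![0, 1] : Fin 2 → ZMod 2) !![0, xVar s + xVar t - xVar i - xVar j; aVar X, 0]
        !![0, xVar s * xVar t - xVar i * xVar j; 0, 0] *
      Matrix.submatrix
        !![xVar j - xVar s, 0, 0, 0; 0, -1, 1, 0; 0, xVar j, -xVar s, 0; 0, 0, 0, -1]
        finProdFinEquiv finProdFinEquiv
  rw [leibniz_koszul, leibniz_koszul, Matrix.submatrix_mul_equiv, Matrix.submatrix_mul_equiv]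
  congr 1
  refine Matrix.ext fun k l => ?_
  fin_cases k <;> fin_cases l <;> simp [Matrix.mul_apply, Fin.sum_univ_four] <;> ring

/-- `χ¹ ∘ χ⁰` is multiplication by `x_j - x_s`. -/
theorem chiOne_mul_chiZero {X : Type*} (i j s t : X) :
    chiOne i j s t * chiZero i j s t =
      Matrix.diagonal fun _ => xVar j - xVar s := by
  change Matrix.submatrix
        !![1, 0, 0, 0; 0, xVar s, 1, 0; 0, xVar j, 1, 0; 0, 0, 0, xVar s - xVar j]
        finProdFinEquiv finProdFinEquiv *
      Matrix.submatrix
        !![xVar j - xVar s, 0, 0, 0; 0, -1, 1, 0; 0, xVar j, -xVar s, 0; 0, 0, 0, -1]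
        finProdFinEquiv finProdFinEquiv =
    Matrix.diagonal fun _ : Fin 2 × Fin 2 => xVar j - xVar s
  rw [Matrix.submatrix_mul_equiv]
  refine Eq.trans ?_ (Matrix.submatrix_diagonal_equiv (fun _ : Fin 4 => xVar j - xVar s)
    (finProdFinEquiv : Fin 2 × Fin 2 ≃ Fin 4))
  congr 1
  refine Matrix.ext fun k l => ?_
  fin_cases k <;> fin_cases l <;> simp [Matrix.mul_apply, Fin.sum_univ_four] <;> ring

/-- `χ⁰ ∘ χ¹` is multiplication by `x_j - x_s`. -/
theorem chiZero_mul_chiOne {X : Type*} (i j s t : X) :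
    chiZero i j s t * chiOne i j s t =
      Matrix.diagonal fun _ => xVar j - xVar s := by
  change Matrix.submatrix
        !![xVar j - xVar s, 0, 0, 0; 0, -1, 1, 0; 0, xVar j, -xVar s, 0; 0, 0, 0, -1]
        finProdFinEquiv finProdFinEquiv *
      Matrix.submatrix
        !![1, 0, 0, 0; 0, xVar s, 1, 0; 0, xVar j, 1, 0; 0, 0, 0, xVar s - xVar j]
        finProdFinEquiv finProdFinEquiv =
    Matrix.diagonal fun _ : Fin 2 × Fin 2 => xVar j - xVar s
  rw [Matrix.submatrix_mul_equiv]
  refine Eq.trans ?_ (Matrix.submatrix_diagonal_equiv (fun _ : Fin 4 => xVar j - xVar s)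
    (finProdFinEquiv : Fin 2 × Fin 2 ≃ Fin 4))
  congr 1
  refine Matrix.ext fun k l => ?_
  fin_cases k <;> fin_cases l <;> simp [Matrix.mul_apply, Fin.sum_univ_four] <;> ring

theorem gamma_pot {X : Type*} (i j s t : X) :
    (gammaOne i j s t).pot = (gammaZero i j s t).pot := by
  change aVar X * (xVar s + xVar t - xVar i - xVar j) + 0 * _ =
    aVar X * (xVar s - xVar i) + aVar X * (xVar t - xVar j)
  ring

theorem chiOne_par {X : Type*} (i j s t : X) (k : (gammaZero i j s t).ι)
    (l : (gammaOne i j s t).ι) (h : chiOne i j s t k l ≠ 0) :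
    (gammaZero i j s t).par k = (gammaOne i j s t).par l := by
  obtain ⟨k, k'⟩ := k
  obtain ⟨l, l'⟩ := l
  change Fin 2 at k k' l l'
  fin_cases k <;> fin_cases k' <;> fin_cases l <;> fin_cases l' <;>
    first | rfl | exact absurd rfl h | exact (by decide : (1 : ZMod 2) + 1 = 1 + 1 + 0)

theorem chiZero_par {X : Type*} (i j s t : X) (k : (gammaOne i j s t).ι)
    (l : (gammaZero i j s t).ι) (h : chiZero i j s t k l ≠ 0) :
    (gammaOne i j s t).par k = (gammaZero i j s t).par l := by
  obtain ⟨k, k'⟩ := k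
  obtain ⟨l, l'⟩ := l
  change Fin 2 at k k' l l'
  fin_cases k <;> fin_cases k' <;> fin_cases l <;> fin_cases l' <;>
    first | rfl | exact absurd rfl h | exact (by decide : (1 : ZMod 2) + 1 + 0 = 1 + 1)

/-- `χ¹` is homogeneous of degree `(0,1)`. -/
theorem chiOne_homog {X : Type*} (i j s t : X) (k : (gammaZero i j s t).ι)
    (l : (gammaOne i j s t).ι) :
    IsHomog (chiOne i j s t k l) ((gammaOne i j s t).deg l - (gammaZero i j s t).deg k + (0, 1)) := by
  obtain ⟨k, k'⟩ := k
  obtain ⟨l, l'⟩ := l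
  change Fin 2 at k k' l l'
  fin_cases k <;> fin_cases k' <;> fin_cases l <;> fin_cases l' <;>
    first
    | exact isHomog_zero _
    | exact isHomog_one.of_eq rfl
    | exact (isHomog_xVar s).of_eq rfl
    | exact (isHomog_xVar j).of_eq rfl
    | exact ((isHomog_xVar s).sub (isHomog_xVar j)).of_eq rfl

/-- `χ⁰` is homogeneous of degree `(0,1)`. -/
theorem chiZero_homog {X : Type*} (i j s t : X) (k : (gammaOne i j s t).ι)
    (l : (gammaZero i j s t).ι) :
    IsHomog (chiZero i j s t k l) ((gammaZero i j s t).deg l - (gammaOne i j s t).deg k + (0, 1)) := by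
  obtain ⟨k, k'⟩ := k
  obtain ⟨l, l'⟩ := l
  change Fin 2 at k k' l l'
  fin_cases k <;> fin_cases k' <;> fin_cases l <;> fin_cases l' <;>
    first
    | exact isHomog_zero _
    | exact isHomog_one.of_eq rfl
    | exact isHomog_one.neg.of_eq rfl
    | exact (isHomog_xVar j).of_eq rfl
    | exact (isHomog_xVar s).neg.of_eq rfl
    | exact ((isHomog_xVar j).sub (isHomog_xVar s)).of_eq rfl

/-- The complex of an arc that starts at `x_i` and ends at `x_s`. -/
noncomputable def arcComplex {X : Type*} (i s : X) : MatFacComplex X := (arcFac i s).single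

/-- The complex `0 → C₀(Γ₁)⟨1⟩{1,0} --χ¹--> C₀(Γ₀)⟨1⟩{1,-1} → 0` of a positive crossing, in
homological degrees `-1` and `0`. -/
noncomputable def posCrossing {X : Type*} (i j s t : X) : MatFacComplex X :=
  twoTerm (-1) ((gammaOne i j s t).shift 1 (1, 0)) ((gammaZero i j s t).shift 1 (1, -1))
    (chiOne i j s t) (gamma_pot i j s t)
    (fun k l h => congrArg (· + 1) (chiOne_par i j s t k l h))
    (fun k l => (chiOne_homog i j s t k l).of_eq (by
      change _ = (gammaOne i j s t).deg l + (1, 0) - ((gammaZero i j s t).deg k + (1, -1))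
      ext
      · simp; try ring
      · simp; try ring))
    (chiOne_comm i j s t)

/-- The complex `0 → C₀(Γ₀)⟨1⟩{-1,1} --χ⁰--> C₀(Γ₁)⟨1⟩{-1,0} → 0` of a negative crossing, in
homological degrees `0` and `1`. -/
noncomputable def negCrossing {X : Type*} (i j s t : X) : MatFacComplex X :=
  twoTerm 0 ((gammaZero i j s t).shift 1 (-1, 1)) ((gammaOne i j s t).shift 1 (-1, 0))
    (chiZero i j s t) (gamma_pot i j s t).symm
    (fun k l h => congrArg (· + 1) (chiZero_par i j s t k l h))
    (fun k l => (chiZero_homog i j s t k l).of_eq (by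
      change _ = (gammaZero i j s t).deg l + (-1, 1) - ((gammaOne i j s t).deg k + (-1, 0))
      ext
      · simp; try ring
      · simp; try ring))
    (chiZero_comm i j s t)

/-! ## Closed braids and their markings -/

/-- A braid word on `n + 1` strands: a list of crossings, read from bottom to top along upward
oriented strands.  The entry `(i, b)` is the crossing of the strands in the positions `i` and
`i + 1`; it is positive (the strand that goes from the lower left to the upper right is the over
strand) if `b = true` and negative if `b = false`.  A braid word stands for the closed braid
(diagram) that is obtained by joining the top endpoint to the bottom endpoint in each position. -/
abbrev BraidWord (n : ℕ) := List (Fin n × Bool)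

/-- The permutation of the positions `0, …, n` that sends the bottom position of a strand to its
top position. -/
def BraidWord.perm {n : ℕ} : BraidWord n → Equiv.Perm (Fin (n + 1))
  | [] => 1
  | c :: w => BraidWord.perm w * Equiv.swap c.1.castSucc c.1.succ

/-- The number of components of the closed braid: the number of classes of strands, where the
strand that starts in position `p` is continued by the strand that starts in the position in which
the former ends. -/
noncomputable def BraidWord.numComponents {n : ℕ} (B : BraidWord n) : ℕ :=
  Nat.card (Quot fun p q : Fin (n + 1) => BraidWord.perm B p = q)

/-- The simple tangles into which a closed braid is cut at its marked points, each listed with its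
position and with the marked points at its top endpoints. -/
inductive SimpleTangle (n : ℕ) (X : Type*)
  /-- an arc in the position `p`, ending at the marked point `s` -/
  | arc (p : Fin (n + 1)) (s : X)
  /-- a crossing of positions `i` and `i + 1`, whose upper left endpoint is the marked point `s` and
  whose upper right endpoint is the marked point `t` -/
  | crossing (i : Fin n) (positive : Bool) (s t : X)

namespace SimpleTangle

variable {n : ℕ} {X : Type*}

/-- The marked points at the top endpoints. -/
def tops : SimpleTangle n X → List X
  | arc _ s => [s]
  | crossing _ _ s t => [s, t]

/-- The crossing, if there is one. -/
def crossing? : SimpleTangle n X → Option (Fin n × Bool)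
  | arc _ _ => none
  | crossing i b _ _ => some (i, b)

/-- The tangle involves the strand in position `p`. -/
def Touches (p : Fin (n + 1)) : SimpleTangle n X → Prop
  | arc q _ => p = q
  | crossing i _ _ _ => p = i.castSucc ∨ p = i.succ

/-- If `c p` is the last marked point in position `p` below the tangle, then `T.next c p` is the
last marked point in position `p` after the tangle. -/
def next (c : Fin (n + 1) → X) : SimpleTangle n X → Fin (n + 1) → X
  | arc p s => Function.update c p s
  | crossing i _ s t => Function.update (Function.update c i.castSucc s) i.succ t

/-- The complex `C₀(T)` of the tangle, whose bottom endpoints are given by `c`. -/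
noncomputable def complex (c : Fin (n + 1) → X) : SimpleTangle n X → MatFacComplex X
  | arc p s => arcComplex (c p) s
  | crossing i true s t => posCrossing (c i.castSucc) (c i.succ) s t
  | crossing i false s t => negCrossing (c i.castSucc) (c i.succ) s t

end SimpleTangle

/-- A marking of the closed braid `B`, with set of marked points `X`: finitely many distinct points
in the interiors of the arcs, at least one on each arc and on each circle without crossings.
It is recorded by the list, from bottom to top, of the simple tangles into which the closed braid
is cut. Every arc of the diagram that comes out of a crossing has a first marked point, which is a
top endpoint of the simple tangle of this crossing; each further marked point is the top endpoint
of an arc. -/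
structure Marking {n : ℕ} (B : BraidWord n) (X : Type*) where
  tangles : List (SimpleTangle n X)
  /-- the crossings are those of `B` -/
  word : tangles.filterMap SimpleTangle.crossing? = B
  /-- the last marked point in each position before the closing strands, at which the lowest
  simple tangle in this position starts -/
  base : Fin (n + 1) → X
  closes : tangles.foldl SimpleTangle.next base = base
  touches : ∀ p, ∃ T ∈ tangles, T.Touches p
  /-- each marked point is the top endpoint of exactly one simple tangle -/
  nodup : (tangles.flatMap SimpleTangle.tops).Nodup
  full : ∀ x : X, x ∈ tangles.flatMap SimpleTangle.tops

/-- The tensor product of the complexes of a list of simple tangles, stacked from bottom to top,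
where the lowest ones start at the marked points `c`. -/
noncomputable def stackComplex {n : ℕ} {X : Type*} :
    (Fin (n + 1) → X) → List (SimpleTangle n X) → MatFacComplex X
  | _, [] => MatFacComplex.unit X
  | c, T :: Ts => (T.complex c).tensor (stackComplex (T.next c) Ts)

/-- The chain complex `C₀(B)` of the marked closed braid. -/
noncomputable def Marking.complex {n : ℕ} {B : BraidWord n} {X : Type*} (m : Marking B X) :
    MatFacComplex X :=
  stackComplex m.base m.tangles

theorem SimpleTangle.pot_complex {n : ℕ} {X : Type*} (c : Fin (n + 1) → X)
    (T : SimpleTangle n X) :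
    (T.complex c).pot = aVar X * (∑ p, xVar (T.next c p) - ∑ p, xVar (c p)) := by
  rw [← Finset.sum_sub_distrib]
  cases T with
  | arc p s =>
    rw [Finset.sum_eq_single p]
    · simp only [next, Function.update_self]; rfl
    · intro q _ hq; simp [next, Function.update_of_ne hq]
    · simp
  | crossing i b s t =>
    have hne : i.castSucc ≠ i.succ := (Fin.castSucc_lt_succ (i := i)).ne
    have hpot : ((SimpleTangle.crossing i b s t).complex c).pot =
        aVar X * (xVar s - xVar (c i.castSucc)) + aVar X * (xVar t - xVar (c i.succ)) := by
      cases b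
      · rfl
      · exact gamma_pot _ _ _ _
    rw [hpot, Finset.sum_eq_add i.castSucc i.succ hne]
    · simp only [next, Function.update_self, Function.update_of_ne hne]; ring
    · rintro q _ ⟨h1, h2⟩
      simp [next, Function.update_of_ne h1, Function.update_of_ne h2]
    · simp
    · simp

theorem pot_stackComplex {n : ℕ} {X : Type*} (c : Fin (n + 1) → X)
    (Ts : List (SimpleTangle n X)) :
    (stackComplex c Ts).pot =
      aVar X * (∑ p, xVar (Ts.foldl SimpleTangle.next c p) - ∑ p, xVar (c p)) := by
  induction Ts generalizing c with
  | nil => simp only [List.foldl_nil, sub_self, mul_zero]; rfl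
  | cons T Ts ih =>
    change (T.complex c).pot + (stackComplex (T.next c) Ts).pot = _
    rw [ih, SimpleTangle.pot_complex, List.foldl_cons]; ring

/-- `C₀(B)` is a complex of matrix factorizations of `0`. -/
theorem Marking.pot_complex {n : ℕ} {B : BraidWord n} {X : Type*} (m : Marking B X) :
    m.complex.pot = 0 := by
  rw [Marking.complex, pot_stackComplex, m.closes]; simp

/-! ## Homology -/

/-- The homology `ker d / im d` of a module with a differential (`d ∘ d = 0`). -/
abbrev Homology {R V : Type*} [CommRing R] [AddCommGroup V] [Module R V] (d : V →ₗ[R] V)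
    (_h : d ∘ₗ d = 0) : Type _ :=
  LinearMap.ker d ⧸ (LinearMap.range d).submoduleOf (LinearMap.ker d)

/-- The endomorphism of the homology of `d` induced by an endomorphism `f` that commutes with
`d`. -/
def Homology.map {R V : Type*} [CommRing R] [AddCommGroup V] [Module R V] (d f : V →ₗ[R] V)
    (h : d ∘ₗ d = 0) (hf : f ∘ₗ d = d ∘ₗ f) : Homology d h →ₗ[R] Homology d h :=
  Submodule.mapQ _ _
    (f.restrict (p := LinearMap.ker d) (q := LinearMap.ker d) (fun v hv => by
      rw [LinearMap.mem_ker] at hv ⊢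
      rw [← LinearMap.comp_apply, ← hf, LinearMap.comp_apply, hv, map_zero]))
    (by
      rintro ⟨_, hv⟩ ⟨u, rfl⟩
      exact ⟨f u, (LinearMap.congr_fun hf u).symm⟩)

/-- The `ℚ`-subspace of the homology of `d` that consists of the classes represented by cycles
in the `ℚ`-subspace `G`. -/
def Homology.piece {R V : Type*} [CommRing R] [Algebra ℚ R] [AddCommGroup V] [Module R V]
    [Module ℚ V] [IsScalarTower ℚ R V] (d : V →ₗ[R] V) (h : d ∘ₗ d = 0) (G : Submodule ℚ V) :
    Submodule ℚ (Homology d h) :=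
  (G.comap ((LinearMap.ker d).subtype.restrictScalars ℚ)).map
    (((LinearMap.range d).submoduleOf (LinearMap.ker d)).mkQ.restrictScalars ℚ)

namespace Marking

variable {n : ℕ} {B : BraidWord n} {X : Type*} (m : Marking B X)

/-- The free `R`-module underlying `C₀(B)`. -/
abbrev Chain : Type _ := m.complex.ι → PolyRing X

/-- The differential `d_mf` of `C₀(B)`. -/
noncomputable def dmf : m.Chain →ₗ[PolyRing X] m.Chain := m.complex.d.mulVecLin

/-- The differential `d_χ` of `C₀(B)`. -/
noncomputable def dchi : m.Chain →ₗ[PolyRing X] m.Chain := m.complex.dχ.mulVecLin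

theorem dmf_sq : m.dmf ∘ₗ m.dmf = 0 := by
  rw [dmf, ← Matrix.mulVecLin_mul, m.complex.d_sq, m.pot_complex, zero_smul,
    Matrix.mulVecLin_zero]

theorem dchi_comm : m.dchi ∘ₗ m.dmf = m.dmf ∘ₗ m.dchi := by
  rw [dmf, dchi, ← Matrix.mulVecLin_mul, ← Matrix.mulVecLin_mul, m.complex.dχ_comm]

theorem dchi_sq : m.dchi ∘ₗ m.dchi = 0 := by
  rw [dchi, ← Matrix.mulVecLin_mul, m.complex.dχ_sq, Matrix.mulVecLin_zero]

/-- The differential induced by `d_χ` on `H(C₀(B), d_mf)`. -/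
noncomputable def dchiBar :
    Homology m.dmf m.dmf_sq →ₗ[PolyRing X] Homology m.dmf m.dmf_sq :=
  Homology.map m.dmf m.dchi m.dmf_sq m.dchi_comm

theorem dchiBar_sq : m.dchiBar ∘ₗ m.dchiBar = 0 := by
  ext ⟨v, hv⟩
  have h : m.dchi (m.dchi v) = 0 := LinearMap.congr_fun m.dchi_sq v
  change Submodule.Quotient.mk _ = Submodule.Quotient.mk 0
  congr 1
  exact Subtype.ext h

/-- The HOMFLYPT homology `H₀(B) = H(H(C₀(B), d_mf), d_χ)`. -/
abbrev HOMFLYPT : Type _ := Homology m.dchiBar m.dchiBar_sq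

/-- The component of `C₀(B)` of homological degree `i`, `a`-degree `j` and `x`-degree `k`. -/
noncomputable def chainPiece (i j k : ℤ) : Submodule ℚ m.Chain where
  carrier := {v | ∀ b, (m.complex.hdeg b ≠ i → v b = 0) ∧ IsHomog (v b) ((j, k) - m.complex.deg b)}
  add_mem' := fun {u v} hu hv b =>
    ⟨fun h => by rw [Pi.add_apply, (hu b).1 h, (hv b).1 h, add_zero], (hu b).2.add (hv b).2⟩
  zero_mem' := fun _ => ⟨fun _ => rfl, isHomog_zero _⟩
  smul_mem' := fun c v hv b =>
    ⟨fun h => by rw [Pi.smul_apply, (hv b).1 h, smul_zero],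
      (MvPolynomial.weightedHomogeneousSubmodule ℚ bidegree _).smul_mem c (hv b).2⟩

/-- The component `H₀^{i,j,k}(B)` of homological degree `i`, `a`-degree `j` and `x`-degree `k`. -/
noncomputable def homologyPiece (i j k : ℤ) : Submodule ℚ m.HOMFLYPT :=
  Homology.piece m.dchiBar m.dchiBar_sq (Homology.piece m.dmf m.dmf_sq (m.chainPiece i j k))

/-- `P` is the polynomial `P_{B,i,j}`: `dim_ℚ H₀^{i,j,2T-j}(B) = P(T)` for all large `T`. -/
def IsHilbertPolynomialAt (i j : ℤ) (P : Polynomial ℚ) : Prop :=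
  ∃ T₀ : ℕ, ∀ T : ℕ, T₀ ≤ T →
    (Module.finrank ℚ (m.homologyPiece i j (2 * (T : ℤ) - j)) : ℚ) = P.eval (T : ℚ)

/-- `P` is the Hilbert polynomial `P_B = ∑ P_{B,i,j}` of `H₀(B)` with respect to the polynomial
grading `deg_a + deg_x`, where `P_{B,i,j} = 0` for all but finitely many `(i,j)`. -/
def IsHilbertPolynomial (P : Polynomial ℚ) : Prop :=
  ∃ Q : ℤ × ℤ → Polynomial ℚ, (∀ i j, m.IsHilbertPolynomialAt i j (Q (i, j))) ∧
    (Function.support Q).Finite ∧ P = ∑ᶠ ij, Q ij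

end Marking

/-! ## Hilbert polynomials of graded modules -/

/-! The proof is a Hilbert–Serre argument for $H_0(B)$ as a module over $R$. There are finitely many
marked points, so $R$ is noetherian, and $H_0(B)$, an iterated subquotient of a finite free module,
is noetherian too. Its graded components are finite-dimensional because only finitely many monomials
have a given bidegree. The bound $l-1$ holds because few variables act independently.

An element $r$ acts as zero on $H_0(B)$ if multiplication by $r$ is null-homotopic for $d_{mf}$ (it
then kills the inner homology), or null-homotopic for $d_\chi$ through a homotopy that commutes with
$d_{mf}$ (it then kills the outer homology). A Koszul row $(a_0,a_1)$ makes both $a_0$ and $a_1$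
null-homotopic for $d_{mf}$. Hence $a$ acts as zero, an arc gives $x_s=x_i$, and a crossing gives
$x_s+x_t=x_i+x_j$. At a crossing the opposite $\chi$ is a homotopy for $d_\chi$ and gives $x_s=x_j$,
whence $x_t=x_i$. These identifications run along the strands, so the variables on one component all
act equally, and $l$ elements of degree $(0,2)$ together with the annihilator generate $R$
(`Marking.exists_adjoin_eq_top`). For fixed $(i,j)$, `exists_hilbertPolynomial` then yields a
polynomial of degree less than $l$. As $a$ acts as zero, only $a$-degrees within the range of those
of the basis vectors survive (`Marking.homologyPiece_eq_bot`), so the sum over $(i,j)$ is finite.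

Gradings are encoded by families of orthogonal projections instead of direct sums: homogeneous maps
shift the index, and the projections pass to kernels, quotients and homology. -/

theorem Polynomial.exists_sub_eval_eq {d : ℕ} (q : Polynomial ℚ) (hq : q.degree < d) :
    ∃ P : Polynomial ℚ, P.degree < (d + 1 : ℕ) ∧
      ∀ x : ℚ, P.eval (x + 1) - P.eval x = q.eval x := by
  -- Since $B_{k+1}(x+1)-B_{k+1}(x)=(k+1)x^k$, the Bernoulli polynomials provide a discrete
  -- antiderivative of each monomial.
  refine ⟨∑ k ∈ Finset.range d,
    Polynomial.C (q.coeff k / (k + 1)) * Polynomial.bernoulli (k + 1), ?_, fun x => ?_⟩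
  · refine lt_of_le_of_lt (Polynomial.degree_sum_le _ _)
      ((Finset.sup_lt_iff (WithBot.bot_lt_coe _)).2 fun k hk => ?_)
    rw [Polynomial.degree_lt_iff_coeff_zero]
    intro m hm
    rw [Polynomial.coeff_C_mul, Polynomial.coeff_bernoulli, if_neg, mul_zero]
    have := Finset.mem_range.1 hk
    lia
  · have hsum : q.eval x = ∑ k ∈ Finset.range d, q.coeff k * x ^ k := by
      by_cases h0 : q = 0
      · simp [h0]
      · exact Polynomial.eval_eq_sum_range' ((Polynomial.natDegree_lt_iff_degree_lt h0).2 hq) x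
    rw [hsum, Polynomial.eval_finsetSum, Polynomial.eval_finsetSum, ← Finset.sum_sub_distrib]
    refine Finset.sum_congr rfl fun k _ => ?_
    simp only [Polynomial.eval_mul, Polynomial.eval_C]
    rw [add_comm x 1, Polynomial.bernoulli_eval_one_add]
    have : (k : ℚ) + 1 ≠ 0 := by positivity
    push_cast
    field_simp
    ring

/-- A discrete antiderivative of `q` is unique up to a constant on the integers from `T₀` on; the
constant is fixed by the value at `T₀`. -/
theorem exists_polynomial_of_difference {d T₀ : ℕ} (f : ℕ → ℚ) (q : Polynomial ℚ)
    (hq : q.degree < d) (h : ∀ T, T₀ ≤ T → f (T + 1) - f T = q.eval (T : ℚ)) :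
    ∃ P : Polynomial ℚ, P.degree < (d + 1 : ℕ) ∧ ∀ T, T₀ ≤ T → f T = P.eval (T : ℚ) := by
  obtain ⟨P, hP, hPq⟩ := Polynomial.exists_sub_eval_eq q hq
  refine ⟨P + Polynomial.C (f T₀ - P.eval (T₀ : ℚ)), ?_, fun T hT => ?_⟩
  · refine lt_of_le_of_lt (Polynomial.degree_add_le _ _) (max_lt hP ?_)
    exact lt_of_le_of_lt Polynomial.degree_C_le (by exact_mod_cast Nat.succ_pos d)
  · induction T, hT using Nat.le_induction with
    | base => simp
    | succ T hT ih =>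
      have h1 := h T hT
      have h2 := hPq T
      simp only [Polynomial.eval_add, Polynomial.eval_C] at ih ⊢
      push_cast
      linarith

/-- The family of projections onto the components of a grading. -/
structure IsProjFamily {Γ V : Type*} [AddCommGroup V] [Module ℚ V] (π : Γ → V →ₗ[ℚ] V) : Prop where
  idem : ∀ g v, π g (π g v) = π g v
  orth : ∀ g h, g ≠ h → ∀ v, π g (π h v) = 0

namespace IsProjFamily

variable {Γ V : Type*} [AddCommGroup V] [Module ℚ V] {π : Γ → V →ₗ[ℚ] V}

theorem mem_range (hπ : IsProjFamily π) {g : Γ} {v : V} :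
    v ∈ LinearMap.range (π g) ↔ π g v = v :=
  ⟨by rintro ⟨w, rfl⟩; exact hπ.idem g w, fun h => ⟨v, h⟩⟩

theorem comp (hπ : IsProjFamily π) {Δ : Type*} {f : Δ → Γ} (hf : Function.Injective f) :
    IsProjFamily (fun x => π (f x)) :=
  ⟨fun _ => hπ.idem _, fun _ _ h => hπ.orth _ _ (hf.ne h)⟩

/-- The other ranges all lie in the kernel of `π g`, so the ranges are independent, and a
finite-dimensional space has room for only finitely many nonzero ones. -/
theorem finite_ne_bot [Module.Finite ℚ V] (hπ : IsProjFamily π) :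
    {g | LinearMap.range (π g) ≠ ⊥}.Finite := by
  refine WellFoundedGT.finite_ne_bot_of_iSupIndep fun g => ?_
  rw [Submodule.disjoint_def]
  intro v hv hv'
  have hle : (⨆ (h : Γ) (_ : h ≠ g), LinearMap.range (π h)) ≤ LinearMap.ker (π g) := by
    refine iSup₂_le fun h hh => ?_
    rintro _ ⟨w, rfl⟩
    exact hπ.orth g h hh.symm w
  rw [← hπ.mem_range.1 hv]
  exact hle hv'

end IsProjFamily

section Hilbert

variable {R M : Type*} [CommRing R] [Algebra ℚ R] [AddCommGroup M] [Module R M] [Module ℚ M]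
  [IsScalarTower ℚ R M]

/-- Rational constants and annihilating elements generate `R`, so every element of `R` acts as a
rational scalar and `R`-generators already span over `ℚ`. -/
theorem module_finite_rat_of_adjoin_annihilator [Module.Finite R M]
    (h : Algebra.adjoin ℚ {r : R | ∀ m : M, r • m = 0} = ⊤) : Module.Finite ℚ M := by
  have hsc : ∀ r : R, ∃ c : ℚ, ∀ m : M, r • m = c • m := by
    intro r
    have hr : r ∈ Algebra.adjoin ℚ {r : R | ∀ m : M, r • m = 0} := h ▸ Algebra.mem_top
    induction hr using Algebra.adjoin_induction with
    | mem x hx => exact ⟨0, fun m => by rw [hx m, zero_smul]⟩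
    | algebraMap c => exact ⟨c, fun m => algebraMap_smul R c m⟩
    | add x y _ _ hx hy =>
      obtain ⟨a, ha⟩ := hx
      obtain ⟨b, hb⟩ := hy
      exact ⟨a + b, fun m => by rw [add_smul, add_smul, ha, hb]⟩
    | mul x y _ _ hx hy =>
      obtain ⟨a, ha⟩ := hx
      obtain ⟨b, hb⟩ := hy
      exact ⟨a * b, fun m => by rw [mul_smul, mul_smul, hb, ha]⟩
  obtain ⟨F, hF⟩ := Module.Finite.fg_top (R := R) (M := M)
  refine ⟨⟨F, ?_⟩⟩
  rw [eq_top_iff]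
  intro m _
  have hm : m ∈ Submodule.span R (F : Set M) := hF ▸ Submodule.mem_top
  induction hm using Submodule.span_induction with
  | mem x hx => exact Submodule.subset_span hx
  | zero => exact Submodule.zero_mem _
  | add x y _ _ hx hy => exact Submodule.add_mem _ (hx trivial) (hy trivial)
  | smul r x _ hx =>
    obtain ⟨c, hc⟩ := hsc r
    rw [hc]
    exact Submodule.smul_mem _ _ (hx trivial)

/-- The dimension count for multiplication by `y` of degree one, with kernel `K` and cokernel `C`. -/
theorem finrank_add_finrank_ker_eq {π : ℤ → M →ₗ[ℚ] M} (hπ : IsProjFamily π)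
    (hfin : ∀ T, Module.Finite ℚ (LinearMap.range (π T))) {y : R}
    (hy : ∀ T m, π (T + 1) (y • m) = y • π T m) (T : ℤ) {K C : Type*} [AddCommGroup K] [Module ℚ K]
    [AddCommGroup C] [Module ℚ C] (i : K →ₗ[ℚ] M) (p : M →ₗ[ℚ] C) (hi : Function.Injective i)
    (hp : Function.Surjective p) (hir : ∀ m, m ∈ LinearMap.range i ↔ y • m = 0)
    (hpk : ∀ m, p m = 0 ↔ ∃ n, m = y • n) (πK : K →ₗ[ℚ] K) (πC : C →ₗ[ℚ] C)
    (hK : ∀ v, i (πK v) = π T (i v)) (hC : ∀ v, p (π (T + 1) v) = πC (p v)) :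
    Module.finrank ℚ (LinearMap.range (π (T + 1))) + Module.finrank ℚ (LinearMap.range πK) =
      Module.finrank ℚ (LinearMap.range (π T)) + Module.finrank ℚ (LinearMap.range πC) := by
  have := hfin T
  have := hfin (T + 1)
  -- Rank–nullity is applied to multiplication by `y` on degree `T` and to the projection to the
  -- cokernel on degree `T + 1`. Exactness in the middle (`h3`) identifies the range of `g` with the
  -- kernel of `f`.
  let g : LinearMap.range (π T) →ₗ[ℚ] M :=
    ((LinearMap.lsmul R M y).restrictScalars ℚ) ∘ₗ (LinearMap.range (π T)).subtype
  let f : LinearMap.range (π (T + 1)) →ₗ[ℚ] C := p ∘ₗ (LinearMap.range (π (T + 1))).subtype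
  have hg := LinearMap.finrank_range_add_finrank_ker g
  have hf := LinearMap.finrank_range_add_finrank_ker f
  have h1 : Module.finrank ℚ (LinearMap.range πK) = Module.finrank ℚ (LinearMap.ker g) := by
    rw [← Submodule.finrank_map_subtype_eq,
      (Submodule.equivMapOfInjective i hi (LinearMap.range πK)).finrank_eq]
    refine congrArg (fun S : Submodule ℚ M => Module.finrank ℚ S) (Submodule.ext fun m => ?_)
    constructor
    · rintro ⟨_, ⟨v, rfl⟩, rfl⟩
      refine ⟨⟨i (πK v), i v, (hK v).symm⟩, ?_, rfl⟩
      exact (hir _).1 ⟨_, rfl⟩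
    · rintro ⟨⟨m, hm⟩, hm', rfl⟩
      obtain ⟨v, rfl⟩ := (hir m).2 hm'
      exact ⟨πK v, ⟨v, rfl⟩, (hK v).trans (hπ.mem_range.1 hm)⟩
  have h2 : LinearMap.range f = LinearMap.range πC := by
    ext c
    constructor
    · rintro ⟨⟨_, v, rfl⟩, rfl⟩
      exact ⟨p v, (hC v).symm⟩
    · rintro ⟨c', rfl⟩
      obtain ⟨v, rfl⟩ := hp c'
      exact ⟨⟨π (T + 1) v, v, rfl⟩, hC v⟩
  have h3 : Module.finrank ℚ (LinearMap.range g) = Module.finrank ℚ (LinearMap.ker f) := by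
    rw [← Submodule.finrank_map_subtype_eq]
    refine congrArg (fun S : Submodule ℚ M => Module.finrank ℚ S) (Submodule.ext fun m => ?_)
    constructor
    · rintro ⟨⟨m, hm⟩, rfl⟩
      refine ⟨⟨y • m, hπ.mem_range.2 ?_⟩, (hpk _).2 ⟨m, rfl⟩, rfl⟩
      rw [hy, hπ.mem_range.1 hm]
    · rintro ⟨⟨m, hm⟩, hm', rfl⟩
      obtain ⟨n, rfl⟩ := (hpk m).1 hm'
      exact ⟨⟨π T n, n, rfl⟩, ((hy T n).symm.trans (hπ.mem_range.1 hm))⟩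
  rw [h2] at hf
  omega

/-- Hilbert–Serre by induction on the number of degree-one generators, with `R` fixed and `M`
varying. Generation modulo the annihilator is what makes the induction run: an element that kills a
kernel or cokernel may be dropped from `s`. The projections need not add up to the identity, so one
bidegree `(i, j)` can be examined inside the whole homology. -/
theorem exists_hilbertPolynomial {R : Type*} [CommRing R] [Algebra ℚ R] (s : Finset R) :
    ∀ {M : Type*} [AddCommGroup M] [Module R M] [Module ℚ M] [IsScalarTower ℚ R M]
      [IsNoetherian R M] (π : ℤ → M →ₗ[ℚ] M), IsProjFamily π →
      (∀ T, Module.Finite ℚ (LinearMap.range (π T))) →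
      (∀ y ∈ s, ∀ T m, π (T + 1) (y • m) = y • π T m) →
      Algebra.adjoin ℚ (s ∪ {r : R | ∀ m : M, r • m = 0}) = ⊤ →
      ∃ P : Polynomial ℚ, P.degree < s.card ∧ ∃ T₀ : ℕ, ∀ T : ℕ, T₀ ≤ T →
        (Module.finrank ℚ (LinearMap.range (π T)) : ℚ) = P.eval (T : ℚ) := by
  classical
  induction s using Finset.induction_on with
  | empty =>
    intro M _ _ _ _ _ π hπ _ _ hA
    rw [Finset.coe_empty, Set.empty_union] at hA
    have := module_finite_rat_of_adjoin_annihilator hA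
    have hfin := hπ.finite_ne_bot
    obtain ⟨b, hb⟩ := hfin.bddAbove
    -- All pieces of index above `b` vanish; `toNat` covers a negative `b`.
    refine ⟨0, by simp, (b + 1).toNat, fun T hT => ?_⟩
    have h0 : LinearMap.range (π T) = ⊥ := by
      by_contra hne
      have := hb hne
      lia
    rw [h0, finrank_bot]
    simp
  | insert y s hys ih =>
    intro M _ _ _ _ _ π hπ hfin hs hA
    have hy := hs y (Finset.mem_insert_self y s)
    let K := LinearMap.ker (LinearMap.lsmul R M y)
    let N := LinearMap.range (LinearMap.lsmul R M y)
    have hπK : ∀ T, ∀ v ∈ K, π T v ∈ K := by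
      intro T v hv
      change y • v = 0 at hv
      change y • π T v = 0
      rw [← hy, hv, map_zero]
    have hπN : ∀ T, ∀ v ∈ N, π T v ∈ N := by
      rintro T _ ⟨v, rfl⟩
      refine ⟨π (T - 1) v, ?_⟩
      change y • π (T - 1) v = π T (y • v)
      rw [← hy, sub_add_cancel]
    let πK : ℤ → K →ₗ[ℚ] K := fun T =>
      (π T).restrict (p := K.restrictScalars ℚ) (q := K.restrictScalars ℚ) (hπK T)
    let e := Submodule.Quotient.restrictScalarsEquiv ℚ N
    let πC : ℤ → (M ⧸ N) →ₗ[ℚ] (M ⧸ N) := fun T => e.toLinearMap ∘ₗ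
      Submodule.mapQ (N.restrictScalars ℚ) (N.restrictScalars ℚ) (π T) (hπN T) ∘ₗ e.symm.toLinearMap
    have hC : ∀ T v, πC T (N.mkQ v) = N.mkQ (π T v) := fun _ _ => rfl
    have hdim : ∀ T, _ := fun T => finrank_add_finrank_ker_eq hπ hfin hy T
      (K.subtype.restrictScalars ℚ) (N.mkQ.restrictScalars ℚ) K.subtype_injective N.mkQ_surjective
      (fun m => ⟨by rintro ⟨v, rfl⟩; exact v.2, fun h => ⟨⟨m, h⟩, rfl⟩⟩)
      (fun m => (Submodule.Quotient.mk_eq_zero N).trans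
        ⟨by rintro ⟨n, rfl⟩; exact ⟨n, rfl⟩, by rintro ⟨n, rfl⟩; exact ⟨n, rfl⟩⟩)
      (πK T) (πC (T + 1)) (fun _ => rfl) (fun _ => rfl)
    -- Both the kernel and the cokernel of `y` are annihilated by `y`, so `y` passes from the
    -- generators to the annihilator and `s` alone suffices there.
    have hAmono : ∀ t : Set R, y ∈ t → {r : R | ∀ m : M, r • m = 0} ⊆ t →
        Algebra.adjoin ℚ (s ∪ t) = ⊤ := by
      intro t hyt ht
      rw [eq_top_iff, ← hA]
      refine Algebra.adjoin_mono ?_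
      rintro r (hr | hr)
      · rw [Finset.mem_coe, Finset.mem_insert] at hr
        rcases hr with rfl | hr
        · exact Or.inr hyt
        · exact Or.inl hr
      · exact Or.inr (ht hr)
    obtain ⟨P, hP, T₀, hT₀⟩ := ih (M := K) πK
      ⟨fun T v => Subtype.ext (hπ.idem T v), fun T U h v => Subtype.ext (hπ.orth T U h v)⟩
      (fun T => by
        have := hfin T
        refine Module.Finite.of_injective
          (((K.subtype.restrictScalars ℚ).restrict (p := LinearMap.range (πK T))
            (q := LinearMap.range (π T))) ?_) ?_
        · rintro _ ⟨v, rfl⟩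
          exact ⟨v, rfl⟩
        · intro a b h
          exact Subtype.ext (Subtype.ext (congrArg (LinearMap.range (π T)).subtype h)))
      (fun r hr T m => Subtype.ext (hs r (Finset.mem_insert_of_mem hr) T m))
      (hAmono _ (fun m => Subtype.ext m.2) (fun r hr m => Subtype.ext (hr m)))
    obtain ⟨P', hP', T₁, hT₁⟩ := ih (M := M ⧸ N) πC
      ⟨fun T v => by
        obtain ⟨v, rfl⟩ := N.mkQ_surjective v
        rw [hC, hC, hπ.idem], fun T U h v => by
        obtain ⟨v, rfl⟩ := N.mkQ_surjective v
        rw [hC, hC, hπ.orth T U h, map_zero]⟩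
      (fun T => by
        have := hfin T
        have hr : LinearMap.range (πC T) =
            (LinearMap.range (π T)).map (N.mkQ.restrictScalars ℚ) := by
          ext c
          constructor
          · rintro ⟨v, rfl⟩
            obtain ⟨v, rfl⟩ := N.mkQ_surjective v
            exact ⟨π T v, ⟨v, rfl⟩, rfl⟩
          · rintro ⟨_, ⟨v, rfl⟩, rfl⟩
            exact ⟨N.mkQ v, rfl⟩
        rw [hr]
        infer_instance)
      (fun r hr T m => by
        obtain ⟨v, rfl⟩ := N.mkQ_surjective m
        rw [← map_smul, hC, hC, ← map_smul, hs r (Finset.mem_insert_of_mem hr)])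
      (hAmono _
        (fun m => by
          obtain ⟨v, rfl⟩ := N.mkQ_surjective m
          rw [← map_smul]
          exact (Submodule.Quotient.mk_eq_zero N).2 ⟨v, rfl⟩)
        (fun r hr m => by
          obtain ⟨v, rfl⟩ := N.mkQ_surjective m
          rw [← map_smul, hr v, map_zero]))
    -- The first difference of the Hilbert function at `T` is the cokernel's dimension in degree `T
    -- + 1` minus the kernel's in degree `T`; hence the shift `X + 1`, which preserves the degree.
    have hdeg : (P'.comp (Polynomial.X + 1) - P).degree < s.card := by
      refine lt_of_le_of_lt (Polynomial.degree_sub_le _ _) (max_lt ?_ hP)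
      have := Polynomial.degree_taylor P' 1
      rw [Polynomial.taylor_apply, Polynomial.C_1] at this
      rwa [this]
    have hdiff : ∀ T : ℕ, max T₀ T₁ ≤ T →
        (Module.finrank ℚ (LinearMap.range (π ((T + 1 : ℕ) : ℤ))) : ℚ) -
          Module.finrank ℚ (LinearMap.range (π T)) =
            (P'.comp (Polynomial.X + 1) - P).eval (T : ℚ) := by
      intro T hT
      have h := hdim T
      have h1 := hT₀ T ((le_max_left _ _).trans hT)
      have h2 := hT₁ (T + 1) ((le_max_right _ _).trans (hT.trans (Nat.le_succ T)))
      simp only [Polynomial.eval_sub, Polynomial.eval_comp, Polynomial.eval_add,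
        Polynomial.eval_X, Polynomial.eval_one]
      push_cast at h2 ⊢
      rw [← h1, ← h2, sub_eq_sub_iff_add_eq_add, add_comm (Module.finrank ℚ _ : ℚ)]
      rw [add_comm] at h
      rw [add_comm (Module.finrank ℚ (LinearMap.range (πC _)) : ℚ)]
      exact_mod_cast h
    obtain ⟨Q, hQ, hQT⟩ := exists_polynomial_of_difference
      (fun T : ℕ => (Module.finrank ℚ (LinearMap.range (π T)) : ℚ)) _ hdeg hdiff
    refine ⟨Q, ?_, _, hQT⟩
    rwa [Finset.card_insert_of_notMem hys]

end Hilbert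

/-! ## Projections on homology -/

section HomologyProj

variable {R V : Type*} [CommRing R] [AddCommGroup V] [Module R V]
  (d : V →ₗ[R] V) (hd : d ∘ₗ d = 0)

/-- The homology class of a cycle. -/
def Homology.cls {v : V} (hv : d v = 0) : Homology d hd := Submodule.Quotient.mk ⟨v, hv⟩

variable {d}

theorem Homology.exists_cls (x : Homology d hd) :
    ∃ (v : V) (hv : d v = 0), Homology.cls d hd hv = x := by
  obtain ⟨⟨v, hv⟩, rfl⟩ := Submodule.Quotient.mk_surjective _ x
  exact ⟨v, hv, rfl⟩

theorem Homology.cls_eq_zero {v : V} (hv : d v = 0) :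
    Homology.cls d hd hv = 0 ↔ ∃ u, d u = v :=
  (Submodule.Quotient.mk_eq_zero _).trans Iff.rfl

/-- A null-homotopic scalar acts as zero on the homology. -/
theorem Homology.smul_eq_zero_of_homotopy {r : R} (h : V → V)
    (hh : ∀ v, d v = 0 → d (h v) = r • v) (x : Homology d hd) : r • x = 0 := by
  obtain ⟨⟨v, hv⟩, rfl⟩ := Submodule.Quotient.mk_surjective _ x
  exact (Homology.cls_eq_zero hd (v := r • v) _).2 ⟨h v, hh v hv⟩

variable [Algebra ℚ R] [Module ℚ V] [IsScalarTower ℚ R V]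

variable (d) in
/-- The `ℚ`-linear endomorphism of the homology of `d` induced by a `ℚ`-linear map that preserves
cycles and boundaries. -/
def Homology.mapRat (f : V →ₗ[ℚ] V) (hker : ∀ v, d v = 0 → d (f v) = 0)
    (hrange : ∀ u, ∃ w, d w = f (d u)) : Homology d hd →ₗ[ℚ] Homology d hd :=
  let N := (LinearMap.range d).submoduleOf (LinearMap.ker d)
  let e := Submodule.Quotient.restrictScalarsEquiv ℚ N
  e.toLinearMap ∘ₗ Submodule.mapQ (N.restrictScalars ℚ) (N.restrictScalars ℚ)
    (f.restrict (p := (LinearMap.ker d).restrictScalars ℚ)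
      (q := (LinearMap.ker d).restrictScalars ℚ) hker)
    (by rintro ⟨_, hv⟩ ⟨u, rfl⟩; exact hrange u) ∘ₗ e.symm.toLinearMap

theorem Homology.mem_piece (G : Submodule ℚ V) (x : Homology d hd) :
    x ∈ Homology.piece d hd G ↔ ∃ (v : V) (hv : d v = 0), v ∈ G ∧ Homology.cls d hd hv = x := by
  constructor
  · rintro ⟨⟨v, hv⟩, hG, rfl⟩
    exact ⟨v, hv, hG, rfl⟩
  · rintro ⟨v, hv, hG, rfl⟩
    exact ⟨⟨v, hv⟩, hG, rfl⟩

theorem Homology.finite_piece (G : Submodule ℚ V) [Module.Finite ℚ G] :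
    Module.Finite ℚ (Homology.piece d hd G) := by
  have : Module.Finite ℚ (G.comap ((LinearMap.ker d).subtype.restrictScalars ℚ)) := by
    refine Module.Finite.of_injective
      (((LinearMap.ker d).subtype.restrictScalars ℚ).restrict
        (p := G.comap ((LinearMap.ker d).subtype.restrictScalars ℚ)) (q := G) fun _ h => h) ?_
    intro a b h
    exact Subtype.ext (Subtype.ext (congrArg G.subtype h))
  exact inferInstanceAs (Module.Finite ℚ (Submodule.map _ _))

variable {Γ : Type*} [AddCommGroup Γ] {π : Γ → V →ₗ[ℚ] V} {δ : Γ}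

/-- The projections on the homology of a homogeneous differential. -/
def Homology.proj (hδ : ∀ g v, d (π g v) = π (g + δ) (d v)) (g : Γ) :
    Homology d hd →ₗ[ℚ] Homology d hd :=
  Homology.mapRat d hd (π g) (fun v hv => by rw [hδ, hv, map_zero])
    (fun u => ⟨π (g - δ) u, by rw [hδ, sub_add_cancel]⟩)

variable (hδ : ∀ g v, d (π g v) = π (g + δ) (d v))

theorem Homology.proj_cls (g : Γ) {v : V} (hv : d v = 0) :
    Homology.proj hd hδ g (Homology.cls d hd hv) =
      Homology.cls d hd (v := π g v) (by rw [hδ, hv, map_zero]) := rfl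

theorem Homology.isProjFamily_proj (hπ : IsProjFamily π) : IsProjFamily (Homology.proj hd hδ) := by
  constructor
  · intro g x
    obtain ⟨v, hv, rfl⟩ := Homology.exists_cls hd x
    simp only [Homology.proj_cls, hπ.idem]
  · intro g h hne x
    obtain ⟨v, hv, rfl⟩ := Homology.exists_cls hd x
    simp only [Homology.proj_cls, hπ.orth g h hne]
    exact (Homology.cls_eq_zero hd _).2 ⟨0, map_zero d⟩

/-- Links the two descriptions of a graded component: classes of homogeneous cycles, and the image
of an induced projection. Applied twice, it handles the iterated homology. -/
theorem Homology.range_proj (hπ : IsProjFamily π) (g : Γ) :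
    LinearMap.range (Homology.proj hd hδ g) =
      Homology.piece d hd (LinearMap.range (π g)) := by
  ext x
  rw [Homology.mem_piece]
  constructor
  · rintro ⟨y, rfl⟩
    obtain ⟨v, hv, rfl⟩ := Homology.exists_cls hd y
    exact ⟨π g v, _, ⟨v, rfl⟩, rfl⟩
  · rintro ⟨v, hv, hG, rfl⟩
    refine ⟨Homology.cls d hd hv, ?_⟩
    simp only [Homology.proj_cls, hπ.mem_range.1 hG]

theorem Homology.map_proj {f : V →ₗ[R] V} (hf : f ∘ₗ d = d ∘ₗ f) {ε : Γ}
    (hε : ∀ g v, f (π g v) = π (g + ε) (f v)) (g : Γ) (x : Homology d hd) :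
    Homology.map d f hd hf (Homology.proj hd hδ g x) =
      Homology.proj hd hδ (g + ε) (Homology.map d f hd hf x) := by
  obtain ⟨⟨v, hv⟩, rfl⟩ := Submodule.Quotient.mk_surjective _ x
  exact congrArg Submodule.Quotient.mk (Subtype.ext (hε g v))

theorem Homology.smul_proj {r : R} {ε : Γ} (hε : ∀ g v, r • π g v = π (g + ε) (r • v)) (g : Γ)
    (x : Homology d hd) :
    r • Homology.proj hd hδ g x = Homology.proj hd hδ (g + ε) (r • x) := by
  obtain ⟨⟨v, hv⟩, rfl⟩ := Submodule.Quotient.mk_surjective _ x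
  exact congrArg Submodule.Quotient.mk (Subtype.ext (hε g v))

end HomologyProj

/-! ## The grading of the chain module -/

section Weight

variable {X : Type*}

/-- Wherever a coefficient of `s` is nonzero its exponent has weight `e`, so selecting weight `n +
e` in the product means selecting weight `n` in the other factor. -/
theorem weightedHomogeneousComponent_mul {s : PolyRing X} {e : ℤ × ℤ} (hs : IsHomog s e)
    (n : ℤ × ℤ) (r : PolyRing X) :
    MvPolynomial.weightedHomogeneousComponent bidegree (n + e) (s * r) =
      s * MvPolynomial.weightedHomogeneousComponent bidegree n r := by
  classical
  ext d
  rw [MvPolynomial.coeff_weightedHomogeneousComponent, MvPolynomial.coeff_mul,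
    MvPolynomial.coeff_mul]
  refine Eq.trans (b := ∑ x ∈ Finset.HasAntidiagonal.antidiagonal d,
    if Finsupp.weight bidegree d = n + e then
    MvPolynomial.coeff x.1 s * MvPolynomial.coeff x.2 r else 0) (by split_ifs <;> simp) ?_
  refine Finset.sum_congr rfl fun x hx => ?_
  rw [MvPolynomial.coeff_weightedHomogeneousComponent]
  by_cases hc : MvPolynomial.coeff x.1 s = 0
  · simp [hc]
  · rw [← Finset.HasAntidiagonal.mem_antidiagonal.1 hx, map_add, hs hc, mul_ite, mul_zero]
    exact if_congr (by rw [add_comm n, add_right_inj]) rfl rfl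

theorem fst_weight_bidegree (d : Option X →₀ ℕ) :
    (Finsupp.weight bidegree d).1 = 2 * (d none : ℤ) := by
  rw [Finsupp.weight_apply, ← AddMonoidHom.coe_fst, map_finsuppSum, Finsupp.sum_eq_single none]
  · simp [bidegree]; ring
  · rintro (_ | x) _ h
    · exact absurd rfl h
    · simp [bidegree]
  · simp

/-- All variables have total weight 2, so the bidegree determines the polynomial degree of a
monomial; this is the source of finite-dimensionality. -/
theorem two_mul_degree_eq (d : Option X →₀ ℕ) :
    2 * (d.degree : ℤ) = (Finsupp.weight bidegree d).1 + (Finsupp.weight bidegree d).2 := by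
  rw [Finsupp.weight_apply, ← AddMonoidHom.coe_fst, ← AddMonoidHom.coe_snd, map_finsuppSum,
    map_finsuppSum, ← Finsupp.sum_add, Finsupp.degree_apply, Finsupp.sum]
  push_cast
  rw [Finset.mul_sum]
  refine Finset.sum_congr rfl fun x _ => ?_
  cases x <;> simp [bidegree] <;> ring

theorem finite_weight_bidegree_eq [Finite X] (e : ℤ × ℤ) :
    {d : Option X →₀ ℕ | Finsupp.weight bidegree d = e}.Finite := by
  refine (Finsupp.finite_of_degree_le (σ := Option X) (e.1 + e.2).toNat).subset fun d hd => ?_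
  have := two_mul_degree_eq d
  rw [hd] at this
  change d.degree ≤ _
  lia

theorem finite_weightedHomogeneousSubmodule [Finite X] (e : ℤ × ℤ) :
    Module.Finite ℚ (MvPolynomial.weightedHomogeneousSubmodule ℚ (bidegree (X := X)) e) := by
  rw [MvPolynomial.weightedHomogeneousSubmodule_eq_finsupp_supported]
  have := (finite_weight_bidegree_eq (X := X) e).to_subtype
  exact Module.Finite.of_basis (MvPolynomial.basisRestrictSupport ℚ
    {d : Option X →₀ ℕ | Finsupp.weight bidegree d = e})

/-- Only `a` contributes to the first weight, so positive `a`-degree forces a factor `a` in every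
monomial. -/
theorem IsHomog.aVar_dvd {r : PolyRing X} {e : ℤ × ℤ} (hr : IsHomog r e) (he : 0 < e.1) :
    aVar X ∣ r := by
  rw [MvPolynomial.X_dvd_iff_modMonomial_eq_zero]
  ext d
  rw [MvPolynomial.coeff_zero]
  by_cases h : Finsupp.single none 1 ≤ d
  · exact MvPolynomial.coeff_modMonomial_of_le _ h
  · rw [MvPolynomial.coeff_modMonomial_of_not_le _ h]
    by_contra hd
    have := fst_weight_bidegree d
    rw [hr hd] at this
    refine h (Finsupp.single_le_iff.2 ?_)
    lia

theorem IsHomog.eq_zero_of_neg {r : PolyRing X} {e : ℤ × ℤ} (hr : IsHomog r e) (he : e.1 < 0) :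
    r = 0 := by
  ext d
  by_contra hd
  have := fst_weight_bidegree d
  rw [hr hd] at this
  lia

end Weight

namespace MatFacComplex

variable {X : Type*} (C : MatFacComplex X)

/-- The projection of the chain module onto its component of homological degree `g.1` and
bidegree `g.2`. -/
noncomputable def proj (g : ℤ × (ℤ × ℤ)) : (C.ι → PolyRing X) →ₗ[ℚ] (C.ι → PolyRing X) :=
  LinearMap.pi fun b => if C.hdeg b = g.1 then
    MvPolynomial.weightedHomogeneousComponent bidegree (g.2 - C.deg b) ∘ₗ LinearMap.proj b else 0

theorem proj_apply (g : ℤ × (ℤ × ℤ)) (v : C.ι → PolyRing X) (b : C.ι) :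
    C.proj g v b = if C.hdeg b = g.1 then
      MvPolynomial.weightedHomogeneousComponent bidegree (g.2 - C.deg b) (v b) else 0 := by
  rw [proj, LinearMap.pi_apply]
  split_ifs <;> rfl

theorem isProjFamily_proj : IsProjFamily C.proj := by
  constructor
  · intro g v
    ext1 b
    simp only [proj_apply]
    split_ifs
    · exact MvPolynomial.IsWeightedHomogeneous.weightedHomogeneousComponent_same
        (MvPolynomial.weightedHomogeneousComponent_isWeightedHomogeneous _ _)
    · rfl
  · intro g h hne v
    ext1 b
    simp only [proj_apply]
    split_ifs with h1 h2
    · refine MvPolynomial.IsWeightedHomogeneous.weightedHomogeneousComponent_ne _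
        (MvPolynomial.weightedHomogeneousComponent_isWeightedHomogeneous (h.2 - C.deg b) (v b)) ?_
      intro h3
      exact hne (Prod.ext (h1.symm.trans h2) (sub_left_injective h3))
    · exact map_zero _
    · rfl

/-- Serves both differentials: $d_{mf}$ shifts the index by `(0, (1, 1))` and $d_\chi$ by `(1, 0)`.
-/
theorem mulVec_proj {A : Matrix C.ι C.ι (PolyRing X)} {p : ℤ} {e : ℤ × ℤ}
    (hp : ∀ i j, A i j ≠ 0 → C.hdeg i = C.hdeg j + p)
    (he : ∀ i j, IsHomog (A i j) (C.deg j - C.deg i + e)) (g : ℤ × (ℤ × ℤ))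
    (v : C.ι → PolyRing X) :
    A.mulVec (C.proj g v) = C.proj (g + (p, e)) (A.mulVec v) := by
  ext1 b
  have hterm : ∀ j, A b j * C.proj g v j = if C.hdeg b = (g + (p, e)).1 then
      MvPolynomial.weightedHomogeneousComponent bidegree ((g + (p, e)).2 - C.deg b)
        (A b j * v j) else 0 := by
    intro j
    by_cases hA : A b j = 0
    · simp [hA]
    · rw [proj_apply, hp b j hA, mul_ite, mul_zero]
      refine if_congr (add_left_inj p).symm ?_ rfl
      rw [← weightedHomogeneousComponent_mul (he b j)]
      congr 2
      change g.2 - C.deg j + (C.deg j - C.deg b + e) = g.2 + e - C.deg b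
      abel
  rw [proj_apply]
  simp only [Matrix.mulVec, dotProduct, hterm]
  split_ifs
  · rw [map_sum]
  · exact Finset.sum_const_zero

theorem smul_proj {r : PolyRing X} {e : ℤ × ℤ} (hr : IsHomog r e) (g : ℤ × (ℤ × ℤ))
    (v : C.ι → PolyRing X) : r • C.proj g v = C.proj (g + (0, e)) (r • v) := by
  ext1 b
  rw [Pi.smul_apply, proj_apply, proj_apply, Pi.smul_apply, smul_ite, smul_zero]
  refine if_congr (by simp) ?_ rfl
  rw [smul_eq_mul, smul_eq_mul, ← weightedHomogeneousComponent_mul hr]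
  congr 2
  change g.2 - C.deg b + e = g.2 + e - C.deg b
  abel

end MatFacComplex

/-! ### The induced grading on $H_0(B)$. -/

namespace Marking

variable {n : ℕ} {B : BraidWord n} {X : Type*} (m : Marking B X)

theorem range_proj (i j k : ℤ) :
    LinearMap.range (m.complex.proj (i, (j, k))) = m.chainPiece i j k := by
  ext v
  rw [m.complex.isProjFamily_proj.mem_range]
  constructor
  · intro h b
    have hb := congrFun h b
    rw [MatFacComplex.proj_apply] at hb
    constructor
    · intro hne
      rw [← hb, if_neg hne]
    · rw [← hb]
      split_ifs
      · exact MvPolynomial.weightedHomogeneousComponent_isWeightedHomogeneous _ _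
      · exact isHomog_zero _
  · intro h
    ext1 b
    rw [MatFacComplex.proj_apply]
    split_ifs with hb
    · exact MvPolynomial.IsWeightedHomogeneous.weightedHomogeneousComponent_same (h b).2
    · exact ((h b).1 hb).symm

theorem finite_chainPiece [Finite X] (i j k : ℤ) : Module.Finite ℚ (m.chainPiece i j k) := by
  have := fun b : m.complex.ι => finite_weightedHomogeneousSubmodule (X := X)
    ((j, k) - m.complex.deg b)
  refine Module.Finite.of_injective (N := ∀ b : m.complex.ι,
    MvPolynomial.weightedHomogeneousSubmodule ℚ (bidegree (X := X)) ((j, k) - m.complex.deg b))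
    (LinearMap.pi fun b => (LinearMap.proj b).restrict fun v hv => (hv b).2) ?_
  intro u v h
  refine Subtype.ext (funext fun b => ?_)
  exact congrArg Subtype.val (congrFun h b)

theorem dmf_proj (g : ℤ × (ℤ × ℤ)) (v : m.Chain) :
    m.dmf (m.complex.proj g v) = m.complex.proj (g + (0, (1, 1))) (m.dmf v) :=
  m.complex.mulVec_proj (fun i j h => (m.complex.d_hdeg i j h).trans (add_zero _).symm)
    m.complex.d_homog g v

/-- The projections on the homology with respect to `d_mf`. -/
noncomputable def projMf (g : ℤ × (ℤ × ℤ)) :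
    Homology m.dmf m.dmf_sq →ₗ[ℚ] Homology m.dmf m.dmf_sq :=
  Homology.proj m.dmf_sq m.dmf_proj g

theorem dchiBar_projMf (g : ℤ × (ℤ × ℤ)) (x : Homology m.dmf m.dmf_sq) :
    m.dchiBar (m.projMf g x) = m.projMf (g + (1, 0)) (m.dchiBar x) :=
  Homology.map_proj m.dmf_sq _ m.dchi_comm (fun g v => m.complex.mulVec_proj m.complex.dχ_hdeg
    (fun i j => (m.complex.dχ_homog i j).of_eq (add_zero _).symm) g v) g x

/-- The projections on the HOMFLYPT homology. -/
noncomputable def projH (g : ℤ × (ℤ × ℤ)) : m.HOMFLYPT →ₗ[ℚ] m.HOMFLYPT :=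
  Homology.proj m.dchiBar_sq m.dchiBar_projMf g

theorem isProjFamily_projMf : IsProjFamily m.projMf :=
  Homology.isProjFamily_proj m.dmf_sq m.dmf_proj m.complex.isProjFamily_proj

theorem isProjFamily_projH : IsProjFamily m.projH :=
  Homology.isProjFamily_proj m.dchiBar_sq m.dchiBar_projMf m.isProjFamily_projMf

theorem range_projH (i j k : ℤ) :
    LinearMap.range (m.projH (i, (j, k))) = m.homologyPiece i j k := by
  rw [homologyPiece, ← m.range_proj]
  refine (Homology.range_proj _ _ m.isProjFamily_projMf _).trans ?_
  exact congrArg _ (Homology.range_proj _ _ m.complex.isProjFamily_proj _)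

theorem smul_projH {r : PolyRing X} {e : ℤ × ℤ} (hr : IsHomog r e) (g : ℤ × (ℤ × ℤ))
    (x : m.HOMFLYPT) : r • m.projH g x = m.projH (g + (0, e)) (r • x) :=
  Homology.smul_proj _ _ (Homology.smul_proj _ _ (m.complex.smul_proj hr)) g x

theorem finite_homologyPiece [Finite X] (i j k : ℤ) :
    Module.Finite ℚ (m.homologyPiece i j k) := by
  have := m.finite_chainPiece i j k
  have := Homology.finite_piece m.dmf_sq (m.chainPiece i j k)
  exact Homology.finite_piece m.dchiBar_sq _

end Marking

/-! ## Null-homotopic multiplications -/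

open scoped Kronecker in
-- Both `D` and `h` are odd, so the sign matrix anticommutes with each and the mixed terms cancel.
-- With one of `h`, `k` equal to zero, this extends a homotopy from one tensor factor to the
-- product.
theorem leibniz_anticomm {R ι κ : Type*} [CommRing R] [Fintype ι] [Fintype κ] [DecidableEq ι]
    [DecidableEq κ] (p : ι → ZMod 2) {D h : Matrix ι ι R} {E k : Matrix κ κ R} {u v : R}
    (hD : ∀ i j, D i j ≠ 0 → p i = p j + 1) (hh : ∀ i j, h i j ≠ 0 → p i = p j + 1)
    (hDh : D * h + h * D = u • (1 : Matrix ι ι R)) (hEk : E * k + k * E = v • (1 : Matrix κ κ R)) :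
    leibniz p D E * leibniz p h k + leibniz p h k * leibniz p D E =
      (u + v) • (1 : Matrix (ι × κ) (ι × κ) R) := by
  have h1 : (D * h) ⊗ₖ (1 : Matrix κ κ R) + (h * D) ⊗ₖ (1 : Matrix κ κ R) =
      u • (1 : Matrix (ι × κ) (ι × κ) R) := by
    rw [← Matrix.add_kronecker, hDh, Matrix.smul_kronecker, Matrix.one_kronecker_one]
  have h2 : (1 : Matrix ι ι R) ⊗ₖ (E * k) + (1 : Matrix ι ι R) ⊗ₖ (k * E) =
      v • (1 : Matrix (ι × κ) (ι × κ) R) := by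
    rw [← Matrix.kronecker_add, hEk, Matrix.kronecker_smul, Matrix.one_kronecker_one]
  have hneg : ∀ (A : Matrix ι ι R) (F : Matrix κ κ R), (-A) ⊗ₖ F = -(A ⊗ₖ F) := by
    intro A F
    ext i j
    simp
  rw [add_smul, ← h1, ← h2]
  simp only [leibniz]
  rw [add_mul, mul_add, mul_add, add_mul, mul_add, mul_add]
  simp only [← Matrix.mul_kronecker_mul, sign_mul_sign, one_mul, mul_one]
  rw [sign_mul_of_odd p D hD, sign_mul_of_odd p h hh, hneg, hneg]
  abel

namespace MatFac

variable {X : Type*}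

/-- Multiplication by `r` is homotopic to zero on `M`. -/
def NullHomotopic (M : MatFac X) (r : PolyRing X) : Prop :=
  ∃ h : Matrix M.ι M.ι (PolyRing X), (∀ i j, h i j ≠ 0 → M.par i = M.par j + 1) ∧
    M.d * h + h * M.d = r • (1 : Matrix M.ι M.ι (PolyRing X))

theorem NullHomotopic.add {M : MatFac X} {r s : PolyRing X} (hr : M.NullHomotopic r)
    (hs : M.NullHomotopic s) : M.NullHomotopic (r + s) := by
  obtain ⟨h, hp, hh⟩ := hr
  obtain ⟨k, kp, hk⟩ := hs
  refine ⟨h + k, fun i j hij => ?_, ?_⟩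
  · by_cases h0 : h i j = 0
    · exact kp i j fun h1 => hij (by rw [Matrix.add_apply, h0, h1, add_zero])
    · exact hp i j h0
  · rw [add_smul, ← hh, ← hk, mul_add, add_mul]
    abel

theorem NullHomotopic.shift {M : MatFac X} {r : PolyRing X} (hr : M.NullHomotopic r) (p : ZMod 2)
    (e : ℤ × ℤ) : (M.shift p e).NullHomotopic r := by
  obtain ⟨h, hp, hh⟩ := hr
  refine ⟨h, fun i j hij => ?_, hh⟩
  change M.par i + p = M.par j + p + 1
  rw [hp i j hij]
  ring

theorem NullHomotopic.tensor_left {M : MatFac X} {r : PolyRing X} (hr : M.NullHomotopic r)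
    (N : MatFac X) : (M.tensor N).NullHomotopic r := by
  obtain ⟨h, hp, hh⟩ := hr
  refine ⟨leibniz M.par h 0, fun i j hij => ?_, ?_⟩
  · rcases leibniz_ne_zero hij with ⟨h1, h2⟩ | ⟨_, h2⟩
    · change M.par i.1 + N.par i.2 = M.par j.1 + N.par j.2 + 1
      rw [hp _ _ h1, h2]
      ring
    · exact absurd rfl h2
  · have := leibniz_anticomm M.par (E := N.d) (k := 0) (v := 0) M.d_par hp hh (by simp)
    rw [add_zero] at this
    exact this

theorem NullHomotopic.tensor_right {N : MatFac X} {r : PolyRing X} (hr : N.NullHomotopic r)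
    (M : MatFac X) : (M.tensor N).NullHomotopic r := by
  obtain ⟨h, hp, hh⟩ := hr
  refine ⟨leibniz M.par 0 h, fun i j hij => ?_, ?_⟩
  · rcases leibniz_ne_zero hij with ⟨h1, _⟩ | ⟨h1, h2⟩
    · exact absurd rfl h1
    · change M.par i.1 + N.par i.2 = M.par j.1 + N.par j.2 + 1
      rw [hp _ _ h2, h1]
      ring
  · have := leibniz_anticomm M.par (D := M.d) (h := 0) (u := 0) M.d_par
      (fun _ _ h => absurd rfl h) (by simp) hh
    rw [zero_add] at this
    exact this

/-- The homotopy is the elementary matrix opposite to the entry $a_0$ of the differential; the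
transposed one gives $a_1$. -/
theorem nullHomotopic_koszulRow_left (a₀ a₁ : PolyRing X) (e : ℤ × ℤ) (h₀ : IsHomog a₀ e)
    (h₁ : IsHomog a₁ ((2, 2) - e)) : (koszulRow a₀ a₁ e h₀ h₁).NullHomotopic a₀ := by
  refine ⟨(!![0, 1; 0, 0] : Matrix (Fin 2) (Fin 2) (PolyRing X)), ?_, ?_⟩
  · intro i j
    change Fin 2 at i j
    change (!![0, 1; 0, 0] : Matrix (Fin 2) (Fin 2) (PolyRing X)) i j ≠ 0 →
      (![0, 1] : Fin 2 → ZMod 2) i = (![0, 1] : Fin 2 → ZMod 2) j + 1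
    fin_cases i <;> fin_cases j <;> simp
    decide
  · have h : (!![0, a₁; a₀, 0] : Matrix (Fin 2) (Fin 2) (PolyRing X)) * !![0, 1; 0, 0] +
        !![0, 1; 0, 0] * !![0, a₁; a₀, 0] = a₀ • (1 : Matrix (Fin 2) (Fin 2) (PolyRing X)) := by
      refine Matrix.ext fun i j => ?_
      fin_cases i <;> fin_cases j <;> simp
    exact h

theorem nullHomotopic_koszulRow_right (a₀ a₁ : PolyRing X) (e : ℤ × ℤ) (h₀ : IsHomog a₀ e)
    (h₁ : IsHomog a₁ ((2, 2) - e)) : (koszulRow a₀ a₁ e h₀ h₁).NullHomotopic a₁ := by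
  refine ⟨(!![0, 0; 1, 0] : Matrix (Fin 2) (Fin 2) (PolyRing X)), ?_, ?_⟩
  · intro i j
    change Fin 2 at i j
    change (!![0, 0; 1, 0] : Matrix (Fin 2) (Fin 2) (PolyRing X)) i j ≠ 0 →
      (![0, 1] : Fin 2 → ZMod 2) i = (![0, 1] : Fin 2 → ZMod 2) j + 1
    fin_cases i <;> fin_cases j <;> simp
  · have h : (!![0, a₁; a₀, 0] : Matrix (Fin 2) (Fin 2) (PolyRing X)) * !![0, 0; 1, 0] +
        !![0, 0; 1, 0] * !![0, a₁; a₀, 0] = a₁ • (1 : Matrix (Fin 2) (Fin 2) (PolyRing X)) := by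
      refine Matrix.ext fun i j => ?_
      fin_cases i <;> fin_cases j <;> simp
    exact h

/-- The homotopies `u` and `v` need not be compatible with `f`: only $d_{mf}$ matters here, since
its homology is taken before $d_\chi$ acts. -/
theorem nullHomotopic_twoTerm {h : ℤ} {M N : MatFac X} {f : Matrix N.ι M.ι (PolyRing X)}
    {hpot : M.pot = N.pot} {hpar : ∀ i j, f i j ≠ 0 → N.par i = M.par j}
    {hhom : ∀ i j, IsHomog (f i j) (M.deg j - N.deg i)} {hcomm : f * M.d = N.d * f}
    {r : PolyRing X} (hM : M.NullHomotopic r) (hN : N.NullHomotopic r) :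
    (twoTerm h M N f hpot hpar hhom hcomm).NullHomotopic r := by
  obtain ⟨u, up, hu⟩ := hM
  obtain ⟨v, vp, hv⟩ := hN
  refine ⟨Matrix.fromBlocks u 0 0 v, ?_, ?_⟩
  · rintro (i | i) (j | j) hij
    · exact up i j hij
    · exact absurd rfl hij
    · exact absurd rfl hij
    · exact vp i j hij
  · change Matrix.fromBlocks M.d 0 0 N.d * Matrix.fromBlocks u 0 0 v +
      Matrix.fromBlocks u 0 0 v * Matrix.fromBlocks M.d 0 0 N.d =
        r • (1 : Matrix (M.ι ⊕ N.ι) (M.ι ⊕ N.ι) (PolyRing X))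
    rw [Matrix.fromBlocks_multiply, Matrix.fromBlocks_multiply, Matrix.fromBlocks_add,
      ← Matrix.fromBlocks_one, Matrix.fromBlocks_smul, ← hu, ← hv]
    simp

theorem nullHomotopic_gammaZero_aVar (i j s t : X) : (gammaZero i j s t).NullHomotopic (aVar X) :=
  (nullHomotopic_koszulRow_left _ _ _ _ _).tensor_left _

theorem nullHomotopic_gammaOne_aVar (i j s t : X) : (gammaOne i j s t).NullHomotopic (aVar X) :=
  ((nullHomotopic_koszulRow_left _ _ _ _ _).tensor_left _).shift _ _

/-- For $\Gamma_0$ the element is the sum of the second entries of the two rows, whereas for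
$\Gamma_1$ it is a single such entry. It is thus null-homotopic at both ends of a crossing complex.
-/
theorem nullHomotopic_gammaZero_sum (i j s t : X) :
    (gammaZero i j s t).NullHomotopic (xVar s + xVar t - xVar i - xVar j) := by
  have h := NullHomotopic.add
    ((nullHomotopic_koszulRow_right _ _ _ _ _ : (arcFac i s).NullHomotopic _).tensor_left
      (arcFac j t))
    ((nullHomotopic_koszulRow_right _ _ _ _ _ : (arcFac j t).NullHomotopic _).tensor_right
      (arcFac i s))
  rwa [show xVar s - xVar i + (xVar t - xVar j) = xVar s + xVar t - xVar i - xVar j by ring] at h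

theorem nullHomotopic_gammaOne_sum (i j s t : X) :
    (gammaOne i j s t).NullHomotopic (xVar s + xVar t - xVar i - xVar j) :=
  ((nullHomotopic_koszulRow_right _ _ _ _ _).tensor_left _).shift _ _

end MatFac

/-! ### Homotopies for $d_\chi$. -/

namespace MatFacComplex

variable {X : Type*}

/-- Multiplication by `r` is homotopic to zero with respect to `dχ`, by a homotopy that commutes
with the differential of the matrix factorizations. -/
def ChiNullHomotopic (C : MatFacComplex X) (r : PolyRing X) : Prop :=
  ∃ k : Matrix C.ι C.ι (PolyRing X), (∀ i j, k i j ≠ 0 → C.hdeg j = C.hdeg i + 1) ∧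
    (∀ i j, k i j ≠ 0 → C.par i = C.par j) ∧ k * C.d = C.d * k ∧
    C.dχ * k + k * C.dχ = r • (1 : Matrix C.ι C.ι (PolyRing X))

/-- Modulo 2, lowering the homological degree by one is the same as raising it, so `k` counts as odd
in `leibniz_anticomm`. -/
theorem hdeg_mod_two (C : MatFacComplex X) {k : Matrix C.ι C.ι (PolyRing X)}
    (hk : ∀ i j, k i j ≠ 0 → C.hdeg j = C.hdeg i + 1) (i j : C.ι) (h : k i j ≠ 0) :
    ((C.hdeg i : ℤ) : ZMod 2) = ((C.hdeg j : ℤ) : ZMod 2) + 1 := by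
  rw [hk i j h]
  push_cast
  rw [add_assoc, show (1 : ZMod 2) + 1 = 0 by decide, add_zero]

theorem dχ_hdeg_mod_two (C : MatFacComplex X) (i j : C.ι) (h : C.dχ i j ≠ 0) :
    ((C.hdeg i : ℤ) : ZMod 2) = ((C.hdeg j : ℤ) : ZMod 2) + 1 := by
  rw [C.dχ_hdeg i j h]
  push_cast
  rfl

theorem d_hdeg_mod_two (C : MatFacComplex X) (i j : C.ι) (h : C.d i j ≠ 0) :
    ((C.hdeg i : ℤ) : ZMod 2) = ((C.hdeg j : ℤ) : ZMod 2) := by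
  rw [C.d_hdeg i j h]

/-- Two sign rules meet: $d_{mf}$ carries the sign of the parity and the homotopy that of the
homological degree. As `k` preserves parity and $d_{mf}$ preserves homological degree,
`leibniz_comm` keeps the two commuting. -/
theorem ChiNullHomotopic.tensor_left {C : MatFacComplex X} {r : PolyRing X}
    (hr : C.ChiNullHomotopic r) (D : MatFacComplex X) : (C.tensor D).ChiNullHomotopic r := by
  obtain ⟨k, hk, kp, kd, kχ⟩ := hr
  refine ⟨leibniz (fun i => ((C.hdeg i : ℤ) : ZMod 2)) k 0, fun i j hij => ?_, fun i j hij => ?_,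
    ?_, ?_⟩
  · rcases leibniz_ne_zero hij with ⟨h1, h2⟩ | ⟨_, h2⟩
    · change C.hdeg j.1 + D.hdeg j.2 = C.hdeg i.1 + D.hdeg i.2 + 1
      rw [hk _ _ h1, h2]
      ring
    · exact absurd rfl h2
  · rcases leibniz_ne_zero hij with ⟨h1, h2⟩ | ⟨_, h2⟩
    · change C.par i.1 + D.par i.2 = C.par j.1 + D.par j.2
      rw [kp _ _ h1, h2]
    · exact absurd rfl h2
  · exact leibniz_comm C.par _ C.d_hdeg_mod_two kp kd (by simp)
  · have := leibniz_anticomm _ (E := D.dχ) (k := 0) (v := 0) C.dχ_hdeg_mod_two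
      (C.hdeg_mod_two hk) kχ (by simp)
    rw [add_zero] at this
    exact this

theorem ChiNullHomotopic.tensor_right {D : MatFacComplex X} {r : PolyRing X}
    (hr : D.ChiNullHomotopic r) (C : MatFacComplex X) : (C.tensor D).ChiNullHomotopic r := by
  obtain ⟨k, hk, kp, kd, kχ⟩ := hr
  refine ⟨leibniz (fun i => ((C.hdeg i : ℤ) : ZMod 2)) 0 k, fun i j hij => ?_, fun i j hij => ?_,
    ?_, ?_⟩
  · rcases leibniz_ne_zero hij with ⟨h1, _⟩ | ⟨h1, h2⟩
    · exact absurd rfl h1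
    · change C.hdeg j.1 + D.hdeg j.2 = C.hdeg i.1 + D.hdeg i.2 + 1
      rw [hk _ _ h2, h1]
      ring
  · rcases leibniz_ne_zero hij with ⟨h1, _⟩ | ⟨h1, h2⟩
    · exact absurd rfl h1
    · change C.par i.1 + D.par i.2 = C.par j.1 + D.par j.2
      rw [kp _ _ h2, h1]
  · exact leibniz_comm C.par _ C.d_hdeg_mod_two (fun _ _ h => absurd rfl h) (by simp) kd
  · have := leibniz_anticomm _ (h := 0) (u := 0) C.dχ_hdeg_mod_two
      (fun _ _ h => absurd rfl h) (by simp) kχ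
    rw [zero_add] at this
    exact this

/-- The backward morphism `g` is itself the homotopy: each of the two terms sees one of the
composites. -/
theorem chiNullHomotopic_twoTerm {h : ℤ} {M N : MatFac X} {f : Matrix N.ι M.ι (PolyRing X)}
    {hpot : M.pot = N.pot} {hpar : ∀ i j, f i j ≠ 0 → N.par i = M.par j}
    {hhom : ∀ i j, IsHomog (f i j) (M.deg j - N.deg i)} {hcomm : f * M.d = N.d * f}
    {r : PolyRing X} (g : Matrix M.ι N.ι (PolyRing X)) (gpar : ∀ i j, g i j ≠ 0 → M.par i = N.par j)
    (gcomm : g * N.d = M.d * g) (hfg : f * g = Matrix.diagonal fun _ => r)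
    (hgf : g * f = Matrix.diagonal fun _ => r) :
    (twoTerm h M N f hpot hpar hhom hcomm).ChiNullHomotopic r := by
  refine ⟨Matrix.fromBlocks 0 g 0 0, ?_, ?_, ?_, ?_⟩
  · rintro (i | i) (j | j) hij
    · exact absurd rfl hij
    · rfl
    · exact absurd rfl hij
    · exact absurd rfl hij
  · rintro (i | i) (j | j) hij
    · exact absurd rfl hij
    · exact gpar i j hij
    · exact absurd rfl hij
    · exact absurd rfl hij
  · have key : Matrix.fromBlocks 0 g 0 0 * Matrix.fromBlocks M.d 0 0 N.d =
        Matrix.fromBlocks M.d 0 0 N.d * Matrix.fromBlocks 0 g 0 0 := by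
      rw [Matrix.fromBlocks_multiply, Matrix.fromBlocks_multiply]
      simp [gcomm]
    exact key
  · have key : Matrix.fromBlocks 0 0 f 0 * Matrix.fromBlocks 0 g 0 0 +
        Matrix.fromBlocks 0 g 0 0 * Matrix.fromBlocks 0 0 f 0 =
          r • (1 : Matrix (M.ι ⊕ N.ι) (M.ι ⊕ N.ι) (PolyRing X)) := by
      rw [Matrix.fromBlocks_multiply, Matrix.fromBlocks_multiply, Matrix.fromBlocks_add, hfg, hgf,
        ← Matrix.fromBlocks_one, Matrix.fromBlocks_smul, Matrix.smul_one_eq_diagonal,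
        Matrix.smul_one_eq_diagonal]
      simp
    exact key

theorem nullHomotopic_negCrossing {i j s t : X} {r : PolyRing X}
    (h₀ : (gammaZero i j s t).NullHomotopic r) (h₁ : (gammaOne i j s t).NullHomotopic r) :
    (negCrossing i j s t).NullHomotopic r := by
  unfold negCrossing
  exact MatFac.nullHomotopic_twoTerm (h₀.shift _ _) (h₁.shift _ _)

theorem nullHomotopic_posCrossing {i j s t : X} {r : PolyRing X}
    (h₀ : (gammaZero i j s t).NullHomotopic r) (h₁ : (gammaOne i j s t).NullHomotopic r) :
    (posCrossing i j s t).NullHomotopic r := by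
  unfold posCrossing
  exact MatFac.nullHomotopic_twoTerm (h₁.shift _ _) (h₀.shift _ _)

theorem chiNullHomotopic_negCrossing (i j s t : X) :
    (negCrossing i j s t).ChiNullHomotopic (xVar j - xVar s) := by
  unfold negCrossing
  exact chiNullHomotopic_twoTerm (chiOne i j s t)
    (fun k l h => congrArg (· + 1) (chiOne_par i j s t k l h)) (chiOne_comm i j s t)
    (chiZero_mul_chiOne i j s t) (chiOne_mul_chiZero i j s t)

theorem chiNullHomotopic_posCrossing (i j s t : X) :
    (posCrossing i j s t).ChiNullHomotopic (xVar j - xVar s) := by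
  unfold posCrossing
  exact chiNullHomotopic_twoTerm (chiZero i j s t)
    (fun k l h => congrArg (· + 1) (chiZero_par i j s t k l h)) (chiZero_comm i j s t)
    (chiOne_mul_chiZero i j s t) (chiZero_mul_chiOne i j s t)

theorem nullHomotopic_arcComplex (i s : X) : (arcComplex i s).NullHomotopic (xVar s - xVar i) :=
  MatFac.nullHomotopic_koszulRow_right (aVar X) (xVar s - xVar i) (2, 0) isHomog_aVar
    (((isHomog_xVar s).sub (isHomog_xVar i)).of_eq rfl)

theorem nullHomotopic_aVar {n : ℕ} (c : Fin (n + 1) → X) (T : SimpleTangle n X) :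
    (T.complex c).NullHomotopic (aVar X) := by
  rcases T with ⟨p, s⟩ | ⟨i, _ | _, s, t⟩
  · exact MatFac.nullHomotopic_koszulRow_left (aVar X) (xVar s - xVar (c p)) (2, 0) isHomog_aVar
      (((isHomog_xVar s).sub (isHomog_xVar (c p))).of_eq rfl)
  · exact nullHomotopic_negCrossing (MatFac.nullHomotopic_gammaZero_aVar _ _ _ _)
      (MatFac.nullHomotopic_gammaOne_aVar _ _ _ _)
  · exact nullHomotopic_posCrossing (MatFac.nullHomotopic_gammaZero_aVar _ _ _ _)
      (MatFac.nullHomotopic_gammaOne_aVar _ _ _ _)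

theorem nullHomotopic_crossing_sum {n : ℕ} (c : Fin (n + 1) → X) (i : Fin n) (b : Bool)
    (s t : X) : ((SimpleTangle.crossing i b s t).complex c).NullHomotopic
      (xVar s + xVar t - xVar (c i.castSucc) - xVar (c i.succ)) := by
  cases b
  · exact nullHomotopic_negCrossing (MatFac.nullHomotopic_gammaZero_sum _ _ _ _)
      (MatFac.nullHomotopic_gammaOne_sum _ _ _ _)
  · exact nullHomotopic_posCrossing (MatFac.nullHomotopic_gammaZero_sum _ _ _ _)
      (MatFac.nullHomotopic_gammaOne_sum _ _ _ _)

theorem chiNullHomotopic_crossing {n : ℕ} (c : Fin (n + 1) → X) (i : Fin n) (b : Bool)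
    (s t : X) : ((SimpleTangle.crossing i b s t).complex c).ChiNullHomotopic
      (xVar (c i.succ) - xVar s) := by
  cases b
  · exact chiNullHomotopic_negCrossing _ _ _ _
  · exact chiNullHomotopic_posCrossing _ _ _ _

end MatFacComplex

/-! ### From homotopies to annihilators of $H_0(B)$. -/

namespace Marking

variable {n : ℕ} {B : BraidWord n} {X : Type*} (m : Marking B X)

theorem smul_eq_zero_of_nullHomotopic {r : PolyRing X} (hr : m.complex.NullHomotopic r)
    (x : Homology m.dmf m.dmf_sq) : r • x = 0 := by
  obtain ⟨h, -, hh⟩ := hr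
  refine Homology.smul_eq_zero_of_homotopy m.dmf_sq h.mulVec (fun v hv => ?_) x
  have := congrArg (fun A => Matrix.mulVec A v) hh
  simp only [Matrix.add_mulVec, ← Matrix.mulVec_mulVec, Matrix.smul_mulVec, Matrix.one_mulVec] at this
  rwa [show m.complex.d.mulVec v = 0 from hv, Matrix.mulVec_zero, add_zero] at this

theorem mem_annihilator_of_nullHomotopic {r : PolyRing X} (hr : m.complex.NullHomotopic r) :
    r ∈ Module.annihilator (PolyRing X) m.HOMFLYPT := by
  rw [Module.mem_annihilator]
  -- Since `r` already kills the inner homology, the zero homotopy works for the outer one.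
  exact Homology.smul_eq_zero_of_homotopy m.dchiBar_sq (fun _ => 0) fun v _ => by
    rw [map_zero, m.smul_eq_zero_of_nullHomotopic hr]

/-- Commuting with $d_{mf}$, the homotopy descends to the inner homology, where it contracts `r`
with respect to the induced differential. -/
theorem mem_annihilator_of_chiNullHomotopic {r : PolyRing X} (hr : m.complex.ChiNullHomotopic r) :
    r ∈ Module.annihilator (PolyRing X) m.HOMFLYPT := by
  rw [Module.mem_annihilator]
  obtain ⟨k, -, -, kd, kχ⟩ := hr
  have hk : k.mulVecLin ∘ₗ m.dmf = m.dmf ∘ₗ k.mulVecLin := by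
    rw [dmf, ← Matrix.mulVecLin_mul, ← Matrix.mulVecLin_mul, kd]
  have hχ : ∀ v, m.dchi (k.mulVecLin v) + k.mulVecLin (m.dchi v) = r • v := by
    intro v
    have := congrArg (fun A => Matrix.mulVec A v) kχ
    simp only [Matrix.add_mulVec, ← Matrix.mulVec_mulVec, Matrix.smul_mulVec,
      Matrix.one_mulVec] at this
    exact this
  refine Homology.smul_eq_zero_of_homotopy m.dchiBar_sq
    (Homology.map m.dmf k.mulVecLin m.dmf_sq hk) fun x hx => ?_
  have hsum : m.dchiBar (Homology.map m.dmf k.mulVecLin m.dmf_sq hk x) +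
      Homology.map m.dmf k.mulVecLin m.dmf_sq hk (m.dchiBar x) = r • x := by
    obtain ⟨⟨v, hv⟩, rfl⟩ := Submodule.Quotient.mk_surjective _ x
    exact congrArg Submodule.Quotient.mk (Subtype.ext (hχ v))
  rwa [hx, map_zero, add_zero] at hsum

end Marking

/-! ## The action of the variables on the homology -/

namespace SimpleTangle

variable {n : ℕ} {X : Type*}

/-- The points at the top endpoints of a tangle are `E`-related to the points at the bottom
endpoints of the same strands. -/
def Follows (E : X → X → Prop) (c : Fin (n + 1) → X) : SimpleTangle n X → Prop
  | arc p s => E s (c p)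
  | crossing i _ s t => E s (c i.succ) ∧ E t (c i.castSucc)

/-- The relation of `SimpleTangle.Follows` for all the tangles of a stack. -/
def StackFollows (E : X → X → Prop) : (Fin (n + 1) → X) → List (SimpleTangle n X) → Prop
  | _, [] => True
  | c, T :: Ts => T.Follows E c ∧ StackFollows E (T.next c) Ts

/-- The word `T.crossing?.toList` has at most one letter, and its permutation, the identity or a
transposition, traces the strands through `T`. -/
theorem Follows.next_perm {E : X → X → Prop} (hE : Equivalence E) {c : Fin (n + 1) → X}
    {T : SimpleTangle n X} (h : T.Follows E c) (p : Fin (n + 1)) :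
    E (T.next c (BraidWord.perm T.crossing?.toList p)) (c p) := by
  rcases T with ⟨q, s⟩ | ⟨i, b, s, t⟩
  · change E (Function.update c q s p) (c p)
    by_cases hp : p = q
    · subst hp
      rw [Function.update_self]
      exact h
    · rw [Function.update_of_ne hp]
      exact hE.refl _
  · change E (Function.update (Function.update c i.castSucc s) i.succ t
      (Equiv.swap i.castSucc i.succ p)) (c p)
    have hne : i.castSucc ≠ i.succ := (Fin.castSucc_lt_succ (i := i)).ne
    by_cases h1 : p = i.castSucc
    · subst h1
      rw [Equiv.swap_apply_left, Function.update_self]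
      exact h.2
    · by_cases h2 : p = i.succ
      · subst h2
        rw [Equiv.swap_apply_right, Function.update_of_ne hne, Function.update_self]
        exact h.1
      · rw [Equiv.swap_apply_of_ne_of_ne h1 h2, Function.update_of_ne h2,
          Function.update_of_ne h1]
        exact hE.refl _

theorem Follows.exists_of_mem_tops {E : X → X → Prop} {c : Fin (n + 1) → X}
    {T : SimpleTangle n X} (h : T.Follows E c) {x : X} (hx : x ∈ T.tops) : ∃ p, E x (c p) := by
  rcases T with ⟨q, s⟩ | ⟨i, b, s, t⟩
  · rw [tops, List.mem_singleton] at hx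
    exact ⟨q, hx ▸ h⟩
  · simp only [tops, List.mem_cons, List.not_mem_nil, or_false] at hx
    rcases hx with rfl | rfl
    · exact ⟨_, h.1⟩
    · exact ⟨_, h.2⟩

theorem perm_filterMap_cons (T : SimpleTangle n X) (Ts : List (SimpleTangle n X))
    (p : Fin (n + 1)) :
    BraidWord.perm ((T :: Ts).filterMap crossing?) p =
      BraidWord.perm (Ts.filterMap crossing?) (BraidWord.perm T.crossing?.toList p) := by
  cases T <;> rfl

/-- For a closed stack the fold returns the base points, so base points of positions linked by the
braid permutation become related. -/
theorem StackFollows.foldl_perm {E : X → X → Prop} (hE : Equivalence E) :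
    ∀ {c : Fin (n + 1) → X} {Ts : List (SimpleTangle n X)}, StackFollows E c Ts → ∀ p,
      E (Ts.foldl next c (BraidWord.perm (Ts.filterMap crossing?) p)) (c p)
  | _, [], _, _ => hE.refl _
  | _, T :: Ts, h, p => by
    rw [perm_filterMap_cons]
    exact hE.trans (StackFollows.foldl_perm hE h.2 _) (h.1.next_perm hE p)

theorem StackFollows.exists_of_mem_tops {E : X → X → Prop} (hE : Equivalence E) :
    ∀ {c : Fin (n + 1) → X} {Ts : List (SimpleTangle n X)}, StackFollows E c Ts →
      ∀ {x : X}, x ∈ Ts.flatMap tops → ∃ p, E x (c p)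
  | _, [], _, x, hx => by simp at hx
  | c, T :: Ts, h, x, hx => by
    rw [List.flatMap_cons, List.mem_append] at hx
    rcases hx with hx | hx
    · exact h.1.exists_of_mem_tops hx
    · obtain ⟨p, hp⟩ := StackFollows.exists_of_mem_tops hE h.2 hx
      -- Each position above `T` is reached from a position below it along a strand.
      obtain ⟨q, rfl⟩ := (BraidWord.perm T.crossing?.toList).surjective p
      exact ⟨q, hE.trans hp (h.1.next_perm hE q)⟩

end SimpleTangle

theorem equivalence_xVar_sub_mem {X : Type*} (I : Ideal (PolyRing X)) :
    Equivalence fun x y : X => (xVar x - xVar y : PolyRing X) ∈ I where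
  refl x := by rw [sub_self]; exact I.zero_mem
  symm h := by rw [← neg_sub]; exact I.neg_mem h
  trans h h' := by rw [← sub_add_sub_cancel]; exact I.add_mem h h'

/-- Homotopies on any tensor factor extend to the stack. At a crossing, adding $x_j-x_s$ to
$x_s+x_t-x_i-x_j$ leaves $x_t-x_i$, so both strands are followed. -/
theorem SimpleTangle.stackFollows_of_nullHomotopic {n : ℕ} {X : Type*} (I : Ideal (PolyRing X)) :
    ∀ (c : Fin (n + 1) → X) (Ts : List (SimpleTangle n X)),
      (∀ r, (stackComplex c Ts).NullHomotopic r → r ∈ I) →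
      (∀ r, (stackComplex c Ts).ChiNullHomotopic r → r ∈ I) →
      StackFollows (fun x y : X => (xVar x - xVar y : PolyRing X) ∈ I) c Ts
  | _, [], _, _ => trivial
  | c, T :: Ts, h, h' => by
    refine ⟨?_, stackFollows_of_nullHomotopic I _ Ts (fun r hr => h r (hr.tensor_right _))
      (fun r hr => h' r (hr.tensor_right _))⟩
    rcases T with ⟨p, s⟩ | ⟨i, b, s, t⟩
    · exact h _ ((MatFacComplex.nullHomotopic_arcComplex (c p) s).tensor_left _)
    · have h1 : xVar s + xVar t - xVar (c i.castSucc) - xVar (c i.succ) ∈ I :=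
        h _ ((MatFacComplex.nullHomotopic_crossing_sum c i b s t).tensor_left _)
      have h2 : xVar (c i.succ) - xVar s ∈ I :=
        h' _ ((MatFacComplex.chiNullHomotopic_crossing c i b s t).tensor_left _)
      constructor
      · change xVar s - xVar (c i.succ) ∈ I
        rw [← neg_sub]
        exact I.neg_mem h2
      · have := I.add_mem h1 h2
        rwa [show xVar s + xVar t - xVar (c i.castSucc) - xVar (c i.succ) +
          (xVar (c i.succ) - xVar s) = xVar t - xVar (c i.castSucc) by ring] at this

namespace Marking

variable {n : ℕ} {B : BraidWord n} {X : Type*} (m : Marking B X)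

theorem finite_points {n : ℕ} {B : BraidWord n} {X : Type*} (m : Marking B X) : Finite X := by
  rw [← Set.finite_univ_iff]
  exact (List.finite_toSet _).subset fun x _ => m.full x

theorem nullHomotopic_aVar : m.complex.NullHomotopic (aVar X) := by
  -- A touched position ensures that the stack is nonempty; the unit complex alone would not make
  -- `a` null-homotopic.
  obtain ⟨T, hT, -⟩ := m.touches 0
  rw [Marking.complex]
  cases h : m.tangles with
  | nil => simp [h] at hT
  | cons T Ts => exact (MatFacComplex.nullHomotopic_aVar m.base T).tensor_left _

/-- The variables at marked points of the same component act equally on the homology, so that one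
representative of each component suffices. -/
theorem exists_adjoin_eq_top : ∃ s : Finset (PolyRing X), s.card ≤ B.numComponents ∧
    (∀ y ∈ s, IsHomog y (0, 2)) ∧
    Algebra.adjoin ℚ (s ∪ {r : PolyRing X | ∀ x : m.HOMFLYPT, r • x = 0}) = ⊤ := by
  classical
  let I := Module.annihilator (PolyRing X) m.HOMFLYPT
  let E : X → X → Prop := fun x y => (xVar x - xVar y : PolyRing X) ∈ I
  have hE : Equivalence E := equivalence_xVar_sub_mem I
  have hst : SimpleTangle.StackFollows E m.base m.tangles :=
    SimpleTangle.stackFollows_of_nullHomotopic I _ _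
      (fun r hr => m.mem_annihilator_of_nullHomotopic hr)
      (fun r hr => m.mem_annihilator_of_chiNullHomotopic hr)
  let rel := fun p q : Fin (n + 1) => BraidWord.perm B p = q
  have hrel : ∀ p q, rel p q → E (m.base p) (m.base q) := by
    rintro p q rfl
    have h := hst.foldl_perm hE p
    rw [m.closes, m.word] at h
    exact hE.symm h
  let S : Setoid X := ⟨E, hE⟩
  let f : Quot rel → Quotient S :=
    Quot.lift (fun p => Quotient.mk S (m.base p)) fun p q h => Quotient.sound (hrel p q h)
  -- Base points are related along components, so one chosen position per component represents all
  -- of them.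
  have hout : ∀ p, E (m.base p) (m.base (Quot.mk rel p).out) := by
    intro p
    have h : f (Quot.mk rel (Quot.mk rel p).out) = f (Quot.mk rel p) := by rw [Quot.out_eq]
    exact hE.symm (Quotient.exact h)
  have : Fintype (Quot rel) := Fintype.ofFinite _
  refine ⟨Finset.univ.image fun q : Quot rel => xVar (m.base q.out), ?_, ?_, ?_⟩
  · refine Finset.card_image_le.trans ?_
    rw [Finset.card_univ, ← Nat.card_eq_fintype_card]
    rfl
  · intro y hy
    obtain ⟨q, -, rfl⟩ := Finset.mem_image.1 hy
    exact isHomog_xVar _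
  · rw [eq_top_iff, ← MvPolynomial.adjoin_range_X]
    refine Algebra.adjoin_le ?_
    have hI : ∀ r ∈ I, ∀ x : m.HOMFLYPT, r • x = 0 := fun r hr => Module.mem_annihilator.1 hr
    -- The variable `a` annihilates; any other variable is its component's representative plus an
    -- annihilating difference.
    rintro _ ⟨_ | x, rfl⟩
    · exact Algebra.subset_adjoin (Or.inr (hI _ (m.mem_annihilator_of_nullHomotopic m.nullHomotopic_aVar)))
    · obtain ⟨p, hp⟩ := hst.exists_of_mem_tops hE (m.full x)
      have h1 := Algebra.subset_adjoin (R := ℚ) (s := (↑(Finset.univ.image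
          fun q : Quot rel => (xVar (m.base q.out) : PolyRing X)) ∪
        {r : PolyRing X | ∀ x : m.HOMFLYPT, r • x = 0})) (Or.inr (hI _ (hE.trans hp (hout p))))
      have h2 := Algebra.subset_adjoin (R := ℚ) (s := (↑(Finset.univ.image
          fun q : Quot rel => (xVar (m.base q.out) : PolyRing X)) ∪
        {r : PolyRing X | ∀ x : m.HOMFLYPT, r • x = 0}))
        (Or.inl (Finset.mem_coe.2 (Finset.mem_image_of_mem _ (Finset.mem_univ (Quot.mk rel p)))))
      have h3 := add_mem h1 h2
      rwa [sub_add_cancel] at h3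

/-! ### Hilbert polynomials for each $(i,j)$ and finiteness of their support. -/

theorem exists_isHilbertPolynomialAt (i j : ℤ) : ∃ P : Polynomial ℚ,
    P.degree < (B.numComponents : WithBot ℕ) ∧ m.IsHilbertPolynomialAt i j P := by
  have := m.finite_points
  obtain ⟨s, hs, hdeg, htop⟩ := m.exists_adjoin_eq_top
  obtain ⟨P, hP, T₀, hT⟩ := exists_hilbertPolynomial s
    -- With `x`-degree `2T - j` the total degree is `2T`, and a variable of degree `(0, 2)` raises
    -- `T` by one.
    (fun T : ℤ => m.projH (i, (j, 2 * T - j)))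
    (m.isProjFamily_projH.comp fun T U h => by
      simp only [Prod.mk.injEq, true_and] at h
      lia)
    (fun T => by
      rw [m.range_projH]
      exact m.finite_homologyPiece _ _ _)
    (fun y hy T x => by
      rw [m.smul_projH (hdeg y hy)]
      congr 2
      ext <;> simp
      ring)
    htop
  refine ⟨P, hP.trans_le (by exact_mod_cast hs), T₀, fun T h => ?_⟩
  rw [← hT T h, m.range_projH]

/-- For `j` below all basis `a`-degrees the coefficients have negative `a`-degree and vanish. For
`j` above them all, a cycle is `a` times a chain, which is itself a cycle because the free module is
torsion-free; its class is then killed by `a`. -/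
theorem homologyPiece_eq_bot {i j : ℤ} (h : (∀ b, m.complex.hdeg b ≠ i) ∨
    (∀ b, j < (m.complex.deg b).1) ∨ ∀ b, (m.complex.deg b).1 < j) (k : ℤ) :
    m.homologyPiece i j k = ⊥ := by
  have hmf : Homology.piece m.dmf m.dmf_sq (m.chainPiece i j k) = ⊥ := by
    rw [eq_bot_iff]
    intro x hx
    obtain ⟨v, hv, hG, rfl⟩ := (Homology.mem_piece m.dmf_sq _ x).1 hx
    rw [Submodule.mem_bot]
    rcases h with h | h | h
    · exact (Homology.cls_eq_zero _ _).2 ⟨0, by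
        rw [map_zero]; exact funext fun b => ((hG b).1 (h b)).symm⟩
    · exact (Homology.cls_eq_zero _ _).2 ⟨0, by
        rw [map_zero]; exact funext fun b => ((hG b).2.eq_zero_of_neg (sub_neg.2 (h b))).symm⟩
    · choose w hw using fun b => (hG b).2.aVar_dvd (sub_pos.2 (h b))
      obtain rfl : v = aVar X • w := funext hw
      have hw0 : m.dmf w = 0 := by
        rw [map_smul] at hv
        exact (smul_eq_zero.1 hv).resolve_left (MvPolynomial.X_ne_zero _)
      exact m.smul_eq_zero_of_nullHomotopic m.nullHomotopic_aVar
        (Homology.cls m.dmf m.dmf_sq hw0)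
  rw [homologyPiece, hmf, eq_bot_iff]
  intro x hx
  obtain ⟨v, hv, hG, rfl⟩ := (Homology.mem_piece m.dchiBar_sq _ x).1 hx
  exact (Homology.cls_eq_zero _ _).2 ⟨0, by rw [map_zero]; exact ((Submodule.mem_bot ℚ).1 hG).symm⟩

variable {m} in
theorem IsHilbertPolynomialAt.eq {i j : ℤ} {P Q : Polynomial ℚ}
    (hP : m.IsHilbertPolynomialAt i j P) (hQ : m.IsHilbertPolynomialAt i j Q) : P = Q := by
  obtain ⟨T₀, h₀⟩ := hP
  obtain ⟨T₁, h₁⟩ := hQ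
  refine Polynomial.eq_of_infinite_eval_eq P Q (Set.Infinite.mono ?_
    ((Set.Ici_infinite (max T₀ T₁)).image (Nat.cast_injective (R := ℚ)).injOn))
  rintro _ ⟨T, hT, rfl⟩
  exact (h₀ T ((le_max_left _ _).trans hT)).symm.trans (h₁ T ((le_max_right _ _).trans hT))

theorem isHilbertPolynomialAt_zero {i j : ℤ} (h : ∀ k, m.homologyPiece i j k = ⊥) :
    m.IsHilbertPolynomialAt i j 0 :=
  ⟨0, fun T _ => by rw [h, finrank_bot]; simp⟩

theorem finite_bidegrees : {ij : ℤ × ℤ | ∃ k, m.homologyPiece ij.1 ij.2 k ≠ ⊥}.Finite := by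
  refine ((Set.finite_range m.complex.hdeg).prod
    (Set.finite_iUnion fun b => Set.finite_iUnion fun b' =>
      Set.finite_Icc (m.complex.deg b).1 (m.complex.deg b').1)).subset ?_
  rintro ⟨i, j⟩ ⟨k, hk⟩
  by_contra hne
  refine hk (m.homologyPiece_eq_bot ?_ k)
  by_contra! hcon
  obtain ⟨⟨b, hb⟩, ⟨b', hb'⟩, b'', hb''⟩ := hcon
  exact hne ⟨⟨b, hb⟩, Set.mem_iUnion.2 ⟨b', Set.mem_iUnion.2 ⟨b'', hb', hb''⟩⟩⟩

end Marking

theorem corollary3p8 {n : ℕ} (B : BraidWord n) {X : Type*} (m : Marking B X) :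
    (∀ i j k : ℤ, Module.Finite ℚ (m.homologyPiece i j k)) ∧
    ∃ P : Polynomial ℚ, m.IsHilbertPolynomial P ∧
      (∀ P' : Polynomial ℚ, m.IsHilbertPolynomial P' → P' = P) ∧
      P.degree ≤ ((B.numComponents - 1 : ℕ) : WithBot ℕ) := by
  have := m.finite_points
  refine ⟨m.finite_homologyPiece, ?_⟩
  choose Q hdeg hQ using fun ij : ℤ × ℤ => m.exists_isHilbertPolynomialAt ij.1 ij.2
  refine ⟨∑ᶠ ij, Q ij, ⟨Q, fun i j => hQ (i, j), ?_, rfl⟩, ?_, ?_⟩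
  · refine m.finite_bidegrees.subset fun ij hij => ?_
    by_contra hne
    simp only [Set.mem_ofPred_eq, not_exists, not_not] at hne
    exact hij ((hQ ij).eq (m.isHilbertPolynomialAt_zero hne))
  · rintro _ ⟨Q', hQ', -, rfl⟩
    exact finsum_congr fun ij => (hQ' ij.1 ij.2).eq (hQ ij)
  · have hlt : (∑ᶠ ij, Q ij).degree < (B.numComponents : WithBot ℕ) :=
      finsum_induction (fun P : Polynomial ℚ => P.degree < (B.numComponents : WithBot ℕ))
        (by rw [Polynomial.degree_zero]; exact WithBot.bot_lt_coe _)
        (fun P P' h h' => (Polynomial.degree_add_le P P').trans_lt (max_lt h h')) hdeg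
    -- Comparing coefficients avoids any trouble with truncated subtraction: `l - 1 < k` gives `l ≤
    -- k` for every natural number `l`.
    rw [Polynomial.degree_le_iff_coeff_zero]
    rw [Polynomial.degree_lt_iff_coeff_zero] at hlt
    intro k hk
    refine hlt k ?_
    have : B.numComponents - 1 < k := by exact_mod_cast hk
    lia
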